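/- Let $t$ be an indeterminate and $K=\mathbb{Q}(t)$. Put $$g(t)=86016t^{14}+6113280t^{12}+71158528t^{10}+145053440t^8-1767894864t^6-8757574840t^4-7679989163t^2+1441328880,$$ $$a(t)=\tfrac{9t^2}{64}\left(5376t^{10}+779520t^8+11657184t^6+57509200t^4+95561365t^2+36613360\right),\qquad b(t)=-\tfrac{9t^2}{512}\,g(t),$$ $$c(t)=\tfrac{9t^2}{16384}\left(336t^6+11320t^4+54229t^2+56560\right)\left(4096t^{12}-71680t^{10}+1220352t^8+24892160t^6+126268912t^4+129848040t^2+50625\right),$$ $$Q(x)=x^6+\tfrac{1}{16}\left(-48t^4-840t^2-707\right)x^4+\tfrac1{256}\left(768t^8+8960t^6-9184t^4-322000t^2+51331\right)x^2+\tfrac{1}{4096}\left(-4096t^{12}+71680t^{10}-1994496t^8-50973440t^6-251212528t^4-260162280t^2-50625\right).$$ Let $E_t$ be the curve $y^2=R(x):=a(t)x^4+b(t)x^2+c(t)$ over $K$, and for $i=0,\dots,5$ let $x_i=\left(t+i-\tfrac52\right)^2$ and $y_i=Q(x_i)$. Let $$\alpha(t)=\tfrac{9}{256}t^2 g(t),$$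 $$\beta(t)=-\tfrac{243t^4}{1024}(4t^2+17)(4t^2+33)(4t^2+97)(28t^2+151)(4t^3-48t^2+t-68)(4t^3-24t^2+9t-26)(4t^3+24t^2+9t+26)(4t^3+48t^2+t+68)(20t^3-24t^2+125t-10)(20t^3+24t^2+125t+10),$$ and let $E_t^*$ be the curve $T^2=S\left(S^2+\alpha(t)S+\beta(t)\right)$. Write $h=(t-\tfrac12)^2$, let $R(x-h)=Ax^4+Bx^3+Cx^2+Dx+E^2$ with $E=Q(h)$, and put, with $u=x+h$, $$S(x,y)=\frac{2E(y+E)+Du}{u^2}+2ah^2+b,\qquad T(x,y)=\frac{4E^2(y+E)}{u^3}+\frac{D(y+3E)}{u^2}+\frac{2CE}{u}+BE.$$ Then: 1. $R$ is a separable polynomial of degree $4$ in $x$, and $y_i^2=R(x_i)$ for $i=0,\dots,5$, so that $(x_i,y_i)\in E_t(K)$. 2. $E_t^*$ is an elliptic curve over $K$, and $E_t$ is birationally equivalent over $K$ to $E_t^*$ (hence their smooth projective models are isomorphic over $K$): there is a $K$-isomorphism from the function field of $E_t^*$ onto that of $E_t$ that sends the coordinate functions $S,T$ to $S(x,y),T(x,y)$.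 3. $(0,0)$ is a point of order $2$ in $E_t^*(K)$. 4. $x_i+h\ne0$ for $i=0,\dots,5$, and the six points $q_i=\left(S(x_i,y_i),T(x_i,y_i)\right)$, which correspond to the points $(x_i,y_i)$, lie in $E_t^*(K)$ and are linearly independent over $\mathbb{Z}$. 5. At $t=\tfrac34$ the values $x_i+h$ are nonzero, the specialization $E^*_{3/4}$ is an elliptic curve over $\mathbb{Q}$, and the six specialized points $q_i$ are linearly independent over $\mathbb Z$ in $E^*_{3/4}(\mathbb{Q})$. 6. The rank of $E_t^*(K)$ is at least $6$. 7. This gives an infinite family of elliptic curves over $\mathbb{Q}$ with a rational $2$-torsion point and rank at least $6$: the set of $j$-invariants of those specializations $E_{t_0}^*$, $t_0\in\mathbb{Q}$, which are elliptic curves, on which $(0,0)$ is a point of order $2$ and for which $E_{t_0}^*(\mathbb{Q})$ has rank at least $6$, is infinite. -/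

import Mathlib

open Polynomial

namespace ConsecutiveSquares

section

variable {K : Type*} [Field K]

/-! All objects are defined for a parameter `t` in a field `K`. The generic case is
`K = RatFunc ℚ` with `t = RatFunc.X`; the specialization at a rational number `t₀` is
`K = ℚ` with `t = t₀`. -/

/-- The coefficient `a(t)` of the quartic `y² = a x⁴ + b x² + c`. -/
def a (t : K) : K :=
  9 * t ^ 2 * (1 / 64 * (5376 * t ^ 10 + 779520 * t ^ 8 + 11657184 * t ^ 6 + 57509200 * t ^ 4
    + 95561365 * t ^ 2 + 36613360))

/-- The coefficient `b(t)`. -/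
def b (t : K) : K :=
  9 * t ^ 2 * (-(1 / 512) * (86016 * t ^ 14 + 6113280 * t ^ 12 + 71158528 * t ^ 10
    + 145053440 * t ^ 8 - 1767894864 * t ^ 6 - 8757574840 * t ^ 4 - 7679989163 * t ^ 2
    + 1441328880))

/-- The coefficient `c(t)`. -/
def c (t : K) : K :=
  9 * t ^ 2 * (1 / 16384 * (336 * t ^ 6 + 11320 * t ^ 4 + 54229 * t ^ 2 + 56560)
    * (4096 * t ^ 12 - 71680 * t ^ 10 + 1220352 * t ^ 8 + 24892160 * t ^ 6
      + 126268912 * t ^ 4 + 129848040 * t ^ 2 + 50625))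

/-- The value `Q(x)` of the monic sextic with `P = Q² - R`, where
`P(x) = ∏ (x² - (t + i)⁴)`, `i = ±1/2, ±3/2, ±5/2`, and `R(x) = a x⁴ + b x² + c`. -/
def Q (t x : K) : K :=
  x ^ 6 + 1 / 16 * (-48 * t ^ 4 - 840 * t ^ 2 - 707) * x ^ 4
    + 1 / 256 * (768 * t ^ 8 + 8960 * t ^ 6 - 9184 * t ^ 4 - 322000 * t ^ 2 + 51331) * x ^ 2
    + (-4096 * t ^ 12 + 71680 * t ^ 10 - 1994496 * t ^ 8 - 50973440 * t ^ 6
      - 251212528 * t ^ 4 - 260162280 * t ^ 2 - 50625) / 4096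

/-- The quartic polynomial `R(x) = a x⁴ + b x² + c`. -/
noncomputable def R (t : K) : K[X] := C (a t) * X ^ 4 + C (b t) * X ^ 2 + C (c t)

/-- The affine coordinate ring `K[x, y] / (y² - R(x))` of the curve `E_t : y² = R(x)`;
the outer variable is `y`. -/
abbrev QuarticRing (t : K) : Type _ := AdjoinRoot (X ^ 2 - C (R t) : K[X][X])

/-- The function field of `E_t` (the fraction ring of its coordinate ring). -/
abbrev QuarticFunctionField (t : K) : Type _ := FractionRing (QuarticRing t)

/-- The function `x` on `E_t`. -/
noncomputable def quarticX (t : K) : QuarticFunctionField t :=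
  algebraMap (QuarticRing t) _ (AdjoinRoot.of _ X)

/-- The function `y` on `E_t`. -/
noncomputable def quarticY (t : K) : QuarticFunctionField t :=
  algebraMap (QuarticRing t) _ (AdjoinRoot.root _)

/-- The `x`-coordinates `x_i = (t + i - 5/2)²`, `i = 0, …, 5`: six consecutive squares. -/
def x (t : K) (i : Fin 6) : K := (t + ((i : ℕ) : K) - 5 / 2) ^ 2

/-- The `y`-coordinates `y_i = Q(x_i)`. -/
def y (t : K) (i : Fin 6) : K := Q t (x t i)

/-- The shift `(t - 1/2)²`. -/
def shift (t : K) : K := (t - 1 / 2) ^ 2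

/-! The coefficients of `R(x - shift) = A x⁴ + B x³ + C x² + D x + E²`. -/

/-- The coefficient of `x³`. -/
def shiftB (t : K) : K := -4 * a t * shift t

/-- The coefficient of `x²`. -/
def shiftC (t : K) : K := 6 * a t * shift t ^ 2 + b t

/-- The coefficient of `x`. -/
def shiftD (t : K) : K := -4 * a t * shift t ^ 3 - 2 * b t * shift t

/-- The square root of the constant term `R(shift)`. -/
def shiftE (t : K) : K := Q t (shift t)

/-- The coefficient `α(t)`. -/
def α (t : K) : K :=
  9 / 256 * t ^ 2 * (86016 * t ^ 14 + 6113280 * t ^ 12 + 71158528 * t ^ 10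
    + 145053440 * t ^ 8 - 1767894864 * t ^ 6 - 8757574840 * t ^ 4 - 7679989163 * t ^ 2
    + 1441328880)

/-- The coefficient `β(t)`. -/
def β (t : K) : K :=
  -(243 * t ^ 4 / 1024) * (4 * t ^ 2 + 17) * (4 * t ^ 2 + 33) * (4 * t ^ 2 + 97)
    * (28 * t ^ 2 + 151) * (4 * t ^ 3 - 48 * t ^ 2 + t - 68)
    * (4 * t ^ 3 - 24 * t ^ 2 + 9 * t - 26) * (4 * t ^ 3 + 24 * t ^ 2 + 9 * t + 26)
    * (4 * t ^ 3 + 48 * t ^ 2 + t + 68) * (20 * t ^ 3 - 24 * t ^ 2 + 125 * t - 10)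
    * (20 * t ^ 3 + 24 * t ^ 2 + 125 * t + 10)

/-- The Weierstrass curve `E_t^* : T² = S (S² + α(t) S + β(t))`. -/
def Estar (t : K) : WeierstrassCurve.Affine K where
  a₁ := 0
  a₂ := α t
  a₃ := 0
  a₄ := β t
  a₆ := 0

/-- The function `S` on `E_t^*`. -/
noncomputable def coordS (t : K) : (Estar t).FunctionField :=
  algebraMap (Estar t).CoordinateRing _ (WeierstrassCurve.Affine.CoordinateRing.mk (Estar t) (C X))

/-- The function `T` on `E_t^*`. -/
noncomputable def coordT (t : K) : (Estar t).FunctionField :=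
  algebraMap (Estar t).CoordinateRing _ (WeierstrassCurve.Affine.CoordinateRing.mk (Estar t) X)

section

variable {F : Type*} [CommRing F] [Algebra K F]

/-- The numerator of `S = sNum / (x + shift)²` as a function of `(x, y)`, evaluated in a
`K`-algebra (either `K` itself or a function field over `K`). -/
def sNum (t : K) (x y : F) : F :=
  let k : K → F := algebraMap K F
  2 * k (shiftE t) * (y + k (shiftE t)) + k (shiftD t) * (x + k (shift t))
    + k (2 * a t * shift t ^ 2 + b t) * (x + k (shift t)) ^ 2

/-- The numerator of `T = tNum / (x + shift)³` as a function of `(x, y)`. -/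
def tNum (t : K) (x y : F) : F :=
  let k : K → F := algebraMap K F
  4 * k (shiftE t) ^ 2 * (y + k (shiftE t))
    + k (shiftD t) * (y + 3 * k (shiftE t)) * (x + k (shift t))
    + 2 * k (shiftC t * shiftE t) * (x + k (shift t)) ^ 2
    + k (shiftB t * shiftE t) * (x + k (shift t)) ^ 3

end

/-- The `S`-coordinate of the point `q_i` on `E_t^*` corresponding to `(x_i, y_i)`. -/
def S (t : K) (i : Fin 6) : K := sNum t (x t i) (y t i) / (x t i + shift t) ^ 2

/-- The `T`-coordinate of the point `q_i` on `E_t^*` corresponding to `(x_i, y_i)`. -/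
def T (t : K) (i : Fin 6) : K := tNum t (x t i) (y t i) / (x t i + shift t) ^ 3

end

end ConsecutiveSquares

/-! The points `(x_i, y_i)` exist because `Q² - R` is the product of the `x² - (t + j)⁴` over `j =
±1/2, ±3/2, ±5/2`, which vanishes at each `x_i`. Since `α = -2b` and `β = b² - 4ac`, the curve
`E_t^*` is the Jacobian of `y² = ax⁴ + bx² + c`. The explicit map sends the rational point `(-h, E)`
of the quartic to the origin; it is inverted by solving for `x` and `y` in terms of `S` and `T`.

Independence is a 2-descent. For a prime `p` and a root `e` in `ℚ_p` of the cubic, `P ↦ S(P) - e` is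
a homomorphism modulo squares, and composing it with the Legendre symbol of the unit part gives a
homomorphism to `ZMod 2` (`descentHom`). Seven such characters, at `p = 31, 43, 53, 103`, give a
nonsingular 7 × 7 matrix over `𝔽₂` on the six points `q_i` and the torsion point `(0, 0)`. As `α² -
4β` is a nonresidue modulo 43, there is no other rational 2-torsion, and an infinite descent on the
coefficients of a relation (`linearIndependent_of_zmod_two_hom`) gives independence over `ℤ`.

The descent only uses that `t` reduces to `3/4` under some embedding of the field into `ℚ_p` for
each of the four primes (`NearThreeQuarters`). This covers `t = 3/4`, the numbers `3/4 +
31·43·53·103·n`, and also the indeterminate, because `ℚ(X)` embeds into `ℚ_p` with `X` sent to a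
transcendental number close to `3/4`. So no specialization theorem is needed. The `j`-invariant is a
nonconstant function of `t`, so the arithmetic progression yields infinitely many values. -/

namespace ConsecutiveSquares

open WeierstrassCurve.Affine

/-! ### 2-descent homomorphisms on a Weierstrass curve. -/

section Descent

variable {K F : Type*} [Field K] [Field F] {W : WeierstrassCurve.Affine K}

/-- A quadratic character of a field with values in `ZMod 2`. -/
structure QuadChar (F : Type*) [Field F] where
  toFun : F → ZMod 2
  map_mul : ∀ u v, u ≠ 0 → v ≠ 0 → toFun (u * v) = toFun u + toFun v

namespace QuadChar

instance : CoeFun (QuadChar F) fun _ => F → ZMod 2 := ⟨toFun⟩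

lemma map_sq (χ : QuadChar F) {u : F} (hu : u ≠ 0) : χ (u ^ 2) = 0 := by
  rw [sq, χ.map_mul u u hu hu, CharTwo.add_self_eq_zero]

lemma map_one (χ : QuadChar F) : χ 1 = 0 := by
  simpa using χ.map_sq (one_ne_zero (α := F))

end QuadChar

/-- The derivative at `e` of the cubic `X³ + a₂X² + a₄X + a₆`, mapped along `σ`. -/
def cubicDeriv (W : WeierstrassCurve.Affine K) (σ : K →+* F) (e : F) : F :=
  3 * e ^ 2 + 2 * σ W.a₂ * e + σ W.a₄

open Classical in
/-- The function `x - e` on points, with the standard modification at the point `x = e`. -/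
noncomputable def descentFun (σ : K →+* F) (e : F) : W.Point → F
  | .zero => 1
  | .some x _ _ => if σ x = e then cubicDeriv W σ e else σ x - e

variable {σ : K →+* F} {e : F}

lemma descentFun_zero : descentFun σ e (0 : W.Point) = 1 := rfl

lemma descentFun_some_of_ne {x y : K} (h : W.Nonsingular x y) (hx : σ x ≠ e) :
    descentFun σ e (Point.some x y h) = σ x - e := by
  simp [descentFun, hx]

lemma descentFun_some_of_eq {x y : K} (h : W.Nonsingular x y) (hx : σ x = e) :
    descentFun σ e (Point.some x y h) = cubicDeriv W σ e := by
  simp [descentFun, hx]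

lemma descentFun_ne_zero (hd : cubicDeriv W σ e ≠ 0) (P : W.Point) : descentFun σ e P ≠ 0 := by
  rcases P with _ | ⟨x, y, h⟩
  · exact one_ne_zero
  · by_cases hx : σ x = e
    · rwa [descentFun_some_of_eq h hx]
    · rw [descentFun_some_of_ne h hx]
      exact sub_ne_zero.mpr hx

/-- On the line through `P` and `Q`, the line squared minus the cubic is `-(X - x₁)(X - x₂)(X -
x₃)`. The two parts are this identity and its derivative, both at `e`; the derivative serves when
the line passes through `(e, 0)`, where the first part degenerates. -/
lemma collinear_identity [DecidableEq K] (h₁ : W.a₁ = 0) (h₃ : W.a₃ = 0) {x₁ x₂ y₁ y₂ : K}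
    (hP : W.Equation x₁ y₁) (hQ : W.Equation x₂ y₂) (hxy : ¬(x₁ = x₂ ∧ y₁ = W.negY x₂ y₂))
    (σ : K →+* F) (e : F) :
    ((σ (W.slope x₁ x₂ y₁ y₂) * (e - σ x₁) + σ y₁) ^ 2 -
        (e ^ 3 + σ W.a₂ * e ^ 2 + σ W.a₄ * e + σ W.a₆) =
      -((e - σ x₁) * (e - σ x₂) * (e - σ (W.addX x₁ x₂ (W.slope x₁ x₂ y₁ y₂))))) ∧
    (2 * σ (W.slope x₁ x₂ y₁ y₂) * (σ (W.slope x₁ x₂ y₁ y₂) * (e - σ x₁) + σ y₁) -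
        cubicDeriv W σ e =
      -((e - σ x₁) * (e - σ x₂) + (e - σ x₁) * (e - σ (W.addX x₁ x₂ (W.slope x₁ x₂ y₁ y₂))) +
          (e - σ x₂) * (e - σ (W.addX x₁ x₂ (W.slope x₁ x₂ y₁ y₂))))) := by
  have h := W.addPolynomial_slope hP hQ hxy
  set ℓ := W.slope x₁ x₂ y₁ y₂
  rw [W.addPolynomial_eq, neg_inj, Cubic.prod_X_sub_C_eq, Cubic.toPoly_injective,
    Cubic.ext_iff] at h
  obtain ⟨-, hb, hc, hd⟩ := h
  simp only [h₁, h₃, zero_mul, neg_zero, sub_zero, add_zero, zero_add, zero_sub] at hb hc hd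
  replace hb := congrArg σ hb
  replace hc := congrArg σ hc
  replace hd := congrArg σ hd
  simp only [map_add, map_sub, map_mul, map_pow, map_neg, map_ofNat] at hb hc hd
  rw [cubicDeriv]
  exact ⟨by linear_combination -e ^ 2 * hb - e * hc - hd, by linear_combination -2 * e * hb - hc⟩

/-- If the line through `P` and `Q` misses `(e, 0)`, the product is the square of its value at `e`.
Otherwise exactly one of the three abscissas is `e`, the product of the other two differences is the
derivative of the cubic at `e`, and this is also the modified value at the point with abscissa `e`.
-/
theorem descentFun_add_isSquare [DecidableEq K] (h₁ : W.a₁ = 0) (h₃ : W.a₃ = 0)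
    (he : e ^ 3 + σ W.a₂ * e ^ 2 + σ W.a₄ * e + σ W.a₆ = 0) (hd : cubicDeriv W σ e ≠ 0)
    (P Q : W.Point) :
    ∃ z, descentFun σ e P * descentFun σ e Q * descentFun σ e (P + Q) = z ^ 2 := by
  rcases P with _ | ⟨x₁, y₁, hP⟩
  · exact ⟨descentFun σ e Q, by rw [← Point.zero_def, zero_add, descentFun_zero]; ring⟩
  rcases Q with _ | ⟨x₂, y₂, hQ⟩
  · exact ⟨descentFun σ e (Point.some x₁ y₁ hP), by
      rw [← Point.zero_def, add_zero, descentFun_zero]; ring⟩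
  by_cases hxy : x₁ = x₂ ∧ y₁ = W.negY x₂ y₂
  · refine ⟨descentFun σ e (Point.some x₁ y₁ hP), ?_⟩
    rw [Point.add_of_Y_eq hxy.1 hxy.2, descentFun_zero]
    obtain ⟨rfl, -⟩ := hxy
    simp only [descentFun]
    ring
  rw [Point.add_some hxy]
  obtain ⟨hc, hc'⟩ := collinear_identity h₁ h₃ hP.1 hQ.1 hxy σ e
  set ℓ := W.slope x₁ x₂ y₁ y₂
  set x₃ := W.addX x₁ x₂ ℓ
  rw [he, sub_zero] at hc
  by_cases hl : σ ℓ * (e - σ x₁) + σ y₁ = 0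
  · rw [hl] at hc hc'
    refine ⟨cubicDeriv W σ e, ?_⟩
    by_cases e₁ : σ x₁ = e
    · have e₂ : σ x₂ ≠ e := fun h => hd (by rw [e₁, h] at hc'; linear_combination -hc')
      have e₃ : σ x₃ ≠ e := fun h => hd (by rw [e₁, h] at hc'; linear_combination -hc')
      rw [descentFun_some_of_eq _ e₁, descentFun_some_of_ne _ e₂, descentFun_some_of_ne _ e₃]
      rw [e₁] at hc'
      linear_combination cubicDeriv W σ e * hc'
    · by_cases e₂ : σ x₂ = e
      · have e₃ : σ x₃ ≠ e := fun h => hd (by rw [e₂, h] at hc'; linear_combination -hc')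
        rw [descentFun_some_of_ne _ e₁, descentFun_some_of_eq _ e₂, descentFun_some_of_ne _ e₃]
        rw [e₂] at hc'
        linear_combination cubicDeriv W σ e * hc'
      · have e₃ : σ x₃ = e := by
          have : (e - σ x₁) * (e - σ x₂) * (e - σ x₃) = 0 := by linear_combination hc
          have n₁ : e - σ x₁ ≠ 0 := sub_ne_zero.mpr (Ne.symm e₁)
          have n₂ : e - σ x₂ ≠ 0 := sub_ne_zero.mpr (Ne.symm e₂)
          have h0 : e - σ x₃ = 0 := by simpa [n₁, n₂] using this
          exact (sub_eq_zero.mp h0).symm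
        rw [descentFun_some_of_ne _ e₁, descentFun_some_of_ne _ e₂, descentFun_some_of_eq _ e₃]
        rw [e₃] at hc'
        linear_combination cubicDeriv W σ e * hc'
  · have hne : (e - σ x₁) * (e - σ x₂) * (e - σ x₃) ≠ 0 := fun h => by
      rw [h, neg_zero] at hc
      exact hl (pow_eq_zero_iff two_ne_zero |>.mp hc)
    have e₁ : σ x₁ ≠ e := fun h => hne (by rw [h]; ring)
    have e₂ : σ x₂ ≠ e := fun h => hne (by rw [h]; ring)
    have e₃ : σ x₃ ≠ e := fun h => hne (by rw [h]; ring)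
    rw [descentFun_some_of_ne _ e₁, descentFun_some_of_ne _ e₂, descentFun_some_of_ne _ e₃]
    exact ⟨σ ℓ * (e - σ x₁) + σ y₁, by linear_combination -hc⟩

/-- The `2`-descent homomorphism `P ↦ χ (x(P) - e)` attached to a root `e` of the cubic. -/
noncomputable def descentHom [DecidableEq K] (h₁ : W.a₁ = 0) (h₃ : W.a₃ = 0)
    (he : e ^ 3 + σ W.a₂ * e ^ 2 + σ W.a₄ * e + σ W.a₆ = 0) (hd : cubicDeriv W σ e ≠ 0)
    (χ : QuadChar F) : W.Point →+ ZMod 2 where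
  toFun P := χ (descentFun σ e P)
  map_zero' := by rw [descentFun_zero, χ.map_one]
  map_add' P Q := by
    obtain ⟨z, hz⟩ := descentFun_add_isSquare h₁ h₃ he hd P Q
    have hP := descentFun_ne_zero hd P
    have hQ := descentFun_ne_zero hd Q
    have hPQ := descentFun_ne_zero hd (P + Q)
    have hz0 : z ≠ 0 := fun h => by simp [h, hP, hQ, hPQ] at hz
    have := χ.map_sq hz0
    rw [← hz, χ.map_mul _ _ (mul_ne_zero hP hQ) hPQ, χ.map_mul _ _ hP hQ] at this
    rw [← CharTwo.add_eq_zero, add_comm, this]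

end Descent

/-! ### From characters modulo 2 to independence over `ℤ`. -/

section Independence

variable {G : Type*} [AddCommGroup G]

/-- If homomorphisms to `ZMod 2` separate `q₁, …, q_n` modulo the `2`-torsion `{0, τ}`, then the
`q_i` are linearly independent over `ℤ`. -/
theorem linearIndependent_of_zmod_two_hom {n : ℕ} {ι : Type*} (τ : G)
    (hτ : ∀ P : G, 2 • P = 0 → P = 0 ∨ P = τ) (q : Fin n → G) (ψ : ι → G →+ ZMod 2)
    (hψ : ∀ (v : Fin n → ZMod 2) (ε : ZMod 2),
      (∀ j, ∑ i, v i * ψ j (q i) = ε * ψ j τ) → v = 0 ∧ ε = 0) :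
    LinearIndependent ℤ q := by
  -- The value `τ` must be allowed: halving an even relation gives a sum killed by 2, which may be
  -- `τ` rather than `0`.
  have key (N : ℕ) : ∀ g : Fin n → ℤ, (∑ i, g i • q i = 0 ∨ ∑ i, g i • q i = τ) →
      ∑ i, (g i).natAbs ≤ N → g = 0 := by
    induction N using Nat.strong_induction_on with
    | _ N ih =>
      intro g hg hN
      have heven : (fun i => (g i : ZMod 2)) = 0 := by
        rcases hg with hg | hg
        · refine (hψ _ 0 fun j => ?_).1
          simpa using congrArg (ψ j) hg
        · refine (hψ _ 1 fun j => ?_).1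
          simpa using congrArg (ψ j) hg
      have hdvd : ∀ i, ∃ m, g i = 2 * m := fun i =>
        (ZMod.intCast_zmod_eq_zero_iff_dvd (g i) 2).mp (congrFun heven i)
      choose m hm using hdvd
      by_contra hne
      have hsum : ∑ i, (g i).natAbs = 2 * ∑ i, (m i).natAbs := by
        rw [Finset.mul_sum]
        exact Finset.sum_congr rfl fun i _ => by rw [hm i, Int.natAbs_mul]; rfl
      have hpos : 0 < ∑ i, (g i).natAbs := by
        obtain ⟨i, hi⟩ := Function.ne_iff.mp hne
        exact Finset.sum_pos' (fun _ _ => Nat.zero_le _)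
          ⟨i, Finset.mem_univ _, Int.natAbs_pos.mpr hi⟩
      refine hne (funext fun i => ?_)
      have hm0 : m = 0 := by
        refine ih (∑ i, (m i).natAbs) (by omega) m ?_ le_rfl
        have h2 : ∑ i, g i • q i = 2 • ∑ i, m i • q i := by
          rw [Finset.smul_sum]
          exact Finset.sum_congr rfl fun i _ => by rw [hm i, mul_smul, ofNat_zsmul]
        rcases hg with hg | hg
        · exact hτ _ (h2 ▸ hg)
        · have := (hψ 0 1 fun j => by
            rw [← hg, h2, map_nsmul, CharTwo.two_nsmul]
            simp).2
          exact absurd this one_ne_zero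
      rw [hm i, hm0]
      rfl
  rw [Fintype.linearIndependent_iff]
  intro g hg i
  exact congrFun (key _ g (Or.inl hg) le_rfl) i

end Independence

/-! ### Residues, Hensel lifting and the quadratic character of `ℚ_p`. -/

section Padic

variable {p : ℕ} [Fact p.Prime]

/-- `x` is a `p`-adic integer with residue `v`. -/
def HasResidue (x : ℚ_[p]) (v : ZMod p) : Prop :=
  ∃ z : ℤ_[p], (z : ℚ_[p]) = x ∧ PadicInt.toZMod z = v

namespace HasResidue

variable {x y : ℚ_[p]} {v w : ZMod p}

lemma add (hx : HasResidue x v) (hy : HasResidue y w) : HasResidue (x + y) (v + w) := by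
  obtain ⟨a, rfl, rfl⟩ := hx
  obtain ⟨b, rfl, rfl⟩ := hy
  exact ⟨a + b, by simp, by simp⟩

lemma sub (hx : HasResidue x v) (hy : HasResidue y w) : HasResidue (x - y) (v - w) := by
  obtain ⟨a, rfl, rfl⟩ := hx
  obtain ⟨b, rfl, rfl⟩ := hy
  exact ⟨a - b, by simp, by simp⟩

lemma neg (hx : HasResidue x v) : HasResidue (-x) (-v) := by
  obtain ⟨a, rfl, rfl⟩ := hx
  exact ⟨-a, by simp, by simp⟩

lemma mul (hx : HasResidue x v) (hy : HasResidue y w) : HasResidue (x * y) (v * w) := by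
  obtain ⟨a, rfl, rfl⟩ := hx
  obtain ⟨b, rfl, rfl⟩ := hy
  exact ⟨a * b, by simp, by simp⟩

lemma pow (hx : HasResidue x v) (n : ℕ) : HasResidue (x ^ n) (v ^ n) := by
  obtain ⟨a, rfl, rfl⟩ := hx
  exact ⟨a ^ n, by simp, by simp⟩

lemma natCast (n : ℕ) : HasResidue (n : ℚ_[p]) (n : ZMod p) := ⟨n, by simp, by simp⟩

lemma one : HasResidue (1 : ℚ_[p]) 1 := ⟨1, by simp, by simp⟩

lemma ofNat (n : ℕ) [n.AtLeastTwo] :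
    HasResidue (OfNat.ofNat n : ℚ_[p]) (OfNat.ofNat n : ZMod p) := by
  exact_mod_cast natCast (p := p) (OfNat.ofNat n)

lemma isUnit_of_toZMod_ne_zero {z : ℤ_[p]} (h : PadicInt.toZMod z ≠ 0) : IsUnit z := by
  by_contra hz
  have : z ∈ RingHom.ker (PadicInt.toZMod (p := p)) := by
    rw [PadicInt.ker_toZMod]
    exact (IsLocalRing.mem_maximalIdeal _).mpr hz
  exact h this

lemma norm_lt_one_of_toZMod_eq_zero {z : ℤ_[p]} (h : PadicInt.toZMod z = 0) : ‖z‖ < 1 := by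
  have : z ∈ RingHom.ker (PadicInt.toZMod (p := p)) := h
  rw [PadicInt.ker_toZMod] at this
  exact PadicInt.mem_nonunits.mp ((IsLocalRing.mem_maximalIdeal _).mp this)

lemma toZMod_eq_zero_of_norm_lt_one {z : ℤ_[p]} (h : ‖z‖ < 1) : PadicInt.toZMod z = 0 := by
  by_contra hz
  exact h.ne (PadicInt.isUnit_iff.mp (isUnit_of_toZMod_ne_zero hz))

lemma ne_zero (hx : HasResidue x v) (hv : v ≠ 0) : x ≠ 0 := by
  obtain ⟨a, rfl, rfl⟩ := hx
  rintro h
  simp only [PadicInt.coe_eq_zero] at h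
  simp [h] at hv

lemma div (hx : HasResidue x v) (hy : HasResidue y w) (hw : w ≠ 0) :
    HasResidue (x / y) (v / w) := by
  have hy0 := hy.ne_zero hw
  obtain ⟨a, rfl, rfl⟩ := hx
  obtain ⟨b, rfl, rfl⟩ := hy
  obtain ⟨u, rfl⟩ := isUnit_of_toZMod_ne_zero hw
  refine ⟨a * (↑u⁻¹ : ℤ_[p]), ?_, ?_⟩
  · rw [eq_div_iff hy0, ← PadicInt.coe_mul, mul_assoc, Units.inv_mul, mul_one]
  · rw [eq_div_iff hw, ← map_mul, mul_assoc, Units.inv_mul, mul_one]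

/-- Square roots lift from the residue field. -/
lemma exists_sq_eq (hp : (2 : ZMod p) ≠ 0) {s : ZMod p} (hs : s ≠ 0) (hx : HasResidue x (s ^ 2)) :
    ∃ y, y ^ 2 = x ∧ HasResidue y s := by
  obtain ⟨a, rfl, ha⟩ := hx
  have hval : PadicInt.toZMod ((s.val : ℤ_[p])) = s := by simp
  have hder : ‖(X ^ 2 - C a).derivative.aeval (s.val : ℤ_[p])‖ = 1 := by
    rw [← PadicInt.isUnit_iff]
    apply isUnit_of_toZMod_ne_zero
    simp only [derivative_sub, derivative_X_pow, derivative_C, sub_zero]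
    simpa [map_ofNat] using ⟨hp, hs⟩
  obtain ⟨z, hz, hz', -⟩ := hensels_lemma (p := p) (R := ℤ_[p]) (F := X ^ 2 - C a)
    (a := (s.val : ℤ_[p])) (by
      rw [hder, one_pow]
      exact norm_lt_one_of_toZMod_eq_zero (by simp [ha]))
  refine ⟨z, ?_, z, rfl, ?_⟩
  · have : z ^ 2 = a := by simpa [sub_eq_zero] using hz
    exact_mod_cast congrArg ((↑) : ℤ_[p] → ℚ_[p]) this
  · rw [hder] at hz'
    have := toZMod_eq_zero_of_norm_lt_one hz'
    rwa [map_sub, hval, sub_eq_zero] at this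

end HasResidue

/-- The unit part of a nonzero `p`-adic number. -/
noncomputable def unitPart (x : ℚ_[p]) : ℚ_[p] := x * (p : ℚ_[p]) ^ (-x.valuation)

open Classical in
/-- The residue in `ZMod p` of the unit part. -/
noncomputable def unitResidue (x : ℚ_[p]) : ZMod p :=
  if h : ‖unitPart x‖ ≤ 1 then PadicInt.toZMod ⟨unitPart x, h⟩ else 0

lemma norm_unitPart {x : ℚ_[p]} (hx : x ≠ 0) : ‖unitPart x‖ = 1 := by
  have hp : (p : ℝ) ≠ 0 := Nat.cast_ne_zero.mpr (Fact.out : p.Prime).ne_zero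
  rw [unitPart, norm_mul, Padic.norm_eq_zpow_neg_valuation hx, Padic.norm_p_zpow, ← zpow_add₀ hp]
  simp

lemma unitPart_mul {x y : ℚ_[p]} (hx : x ≠ 0) (hy : y ≠ 0) :
    unitPart (x * y) = unitPart x * unitPart y := by
  have hp : (p : ℚ_[p]) ≠ 0 := Nat.cast_ne_zero.mpr (Fact.out : p.Prime).ne_zero
  rw [unitPart, Padic.valuation_mul hx hy, neg_add, zpow_add₀ hp]
  simp only [unitPart]
  ring

lemma hasResidue_unitPart {x : ℚ_[p]} (hx : x ≠ 0) : HasResidue (unitPart x) (unitResidue x) := by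
  rw [unitResidue, dif_pos (norm_unitPart hx).le]
  exact ⟨_, rfl, rfl⟩

lemma HasResidue.unique {x : ℚ_[p]} {v w : ZMod p} (hv : HasResidue x v) (hw : HasResidue x w) :
    v = w := by
  obtain ⟨a, rfl, rfl⟩ := hv
  obtain ⟨b, hb, rfl⟩ := hw
  rw [PadicInt.ext hb]

lemma HasResidue.unitResidue_eq {x : ℚ_[p]} {v : ZMod p} (h : HasResidue x v) (hv : v ≠ 0) :
    unitResidue x = v := by
  have hx := h.ne_zero hv
  have hval : x.valuation = 0 := by
    obtain ⟨a, rfl, rfl⟩ := h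
    have hu := PadicInt.isUnit_iff.mp (HasResidue.isUnit_of_toZMod_ne_zero hv)
    rw [PadicInt.norm_def, Padic.norm_eq_zpow_neg_valuation hx] at hu
    have hp : (1 : ℝ) < p := Nat.one_lt_cast.mpr (Fact.out : p.Prime).one_lt
    have := (zpow_eq_one_iff_right₀ (by positivity) hp.ne').mp hu
    omega
  have := hasResidue_unitPart hx
  rw [unitPart, hval] at this
  simp only [neg_zero, zpow_zero, mul_one] at this
  exact this.unique h

lemma unitResidue_ne_zero {x : ℚ_[p]} (hx : x ≠ 0) : unitResidue x ≠ 0 := by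
  intro h
  have hn := norm_unitPart hx
  obtain ⟨z, hz, hz0⟩ := hasResidue_unitPart hx
  rw [h] at hz0
  rw [← hz, ← PadicInt.norm_def] at hn
  exact ((PadicInt.isUnit_iff.mpr hn).map PadicInt.toZMod).ne_zero hz0

lemma unitResidue_mul {x y : ℚ_[p]} (hx : x ≠ 0) (hy : y ≠ 0) :
    unitResidue (x * y) = unitResidue x * unitResidue y := by
  refine (hasResidue_unitPart (mul_ne_zero hx hy)).unique ?_
  rw [unitPart_mul hx hy]
  exact (hasResidue_unitPart hx).mul (hasResidue_unitPart hy)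

variable (p) in
/-- The quadratic character of `ℚ_p` given by the Legendre symbol of the unit part. -/
noncomputable def padicChar : QuadChar ℚ_[p] where
  toFun x := if quadraticChar (ZMod p) (unitResidue x) = 1 then 0 else 1
  map_mul u v hu hv := by
    rw [unitResidue_mul hu hv, map_mul]
    rcases quadraticChar_dichotomy (unitResidue_ne_zero hu) with h | h <;>
      rcases quadraticChar_dichotomy (unitResidue_ne_zero hv) with h' | h' <;> rw [h, h'] <;> decide

lemma padicChar_eq_zero {x : ℚ_[p]} {v : ZMod p} (h : HasResidue x v) (hv : v ≠ 0)
    (hs : ∃ s, s * s = v) : padicChar p x = 0 := by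
  obtain ⟨s, rfl⟩ := hs
  change (if _ then _ else _) = _
  rw [h.unitResidue_eq hv, if_pos ((quadraticChar_one_iff_isSquare hv).mpr ⟨s, rfl⟩)]

lemma padicChar_eq_one {x : ℚ_[p]} {v : ZMod p} (h : HasResidue x v) (hv : v ≠ 0)
    (hs : ∀ s, s * s ≠ v) : padicChar p x = 1 := by
  change (if _ then _ else _) = _
  rw [h.unitResidue_eq hv, if_neg]
  rw [quadraticChar_one_iff_isSquare hv]
  rintro ⟨s, rfl⟩
  exact hs s rfl

end Padic

/-! ### Algebraic identities and 2-torsion for the family. -/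

section Curve

variable {K : Type*} [Field K]

lemma α_eq [CharZero K] (t : K) : α t = -2 * b t := by
  unfold α b
  ring

lemma β_eq [CharZero K] (t : K) : β t = b t ^ 2 - 4 * a t * c t := by
  unfold β a b c
  ring

/-- As `R` is even, this also says that `(-shift, shiftE)` lies on the quartic; it is the point sent
to infinity on `E_t^*`. -/
lemma shiftE_sq [CharZero K] (t : K) :
    shiftE t ^ 2 = a t * shift t ^ 4 + b t * shift t ^ 2 + c t := by
  unfold shiftE Q shift a b c
  field_simp
  ring

lemma y_sq [CharZero K] (t : K) (i : Fin 6) :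
    y t i ^ 2 = a t * x t i ^ 4 + b t * x t i ^ 2 + c t := by
  fin_cases i <;>
  · simp only [y, x, Q, a, b, c]
    push_cast
    field_simp
    ring

lemma y_sq_eq_eval [CharZero K] (t : K) (i : Fin 6) : y t i ^ 2 = (R t).eval (x t i) := by
  rw [y_sq, R]
  simp

section

variable {F : Type*} [CommRing F] [Algebra K F]

/-- The numerators of `S` and `T` satisfy the homogenized equation of `E_t^*`. -/
lemma tNum_sq [CharZero K] (t : K) {x y : F}
    (h : y ^ 2 = algebraMap K F (a t) * x ^ 4 + algebraMap K F (b t) * x ^ 2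
      + algebraMap K F (c t)) :
    tNum t x y ^ 2 = sNum t x y * (sNum t x y ^ 2
      + algebraMap K F (α t) * (x + algebraMap K F (shift t)) ^ 2 * sNum t x y
      + algebraMap K F (β t) * (x + algebraMap K F (shift t)) ^ 4) := by
  have hE := congrArg (algebraMap K F) (shiftE_sq t)
  simp only [tNum, sNum, α_eq, β_eq, shiftB, shiftC, shiftD, map_add, map_sub, map_mul, map_pow,
    map_neg, map_ofNat] at hE ⊢
  generalize algebraMap K F (a t) = A at *
  generalize algebraMap K F (b t) = B at *
  generalize algebraMap K F (shift t) = k at *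
  generalize algebraMap K F (shiftE t) = E at *
  obtain hc : algebraMap K F (c t) = E ^ 2 - A * k ^ 4 - B * k ^ 2 := by linear_combination -hE
  rw [hc] at h ⊢
  -- With `c` eliminated through `E`, the identity holds modulo `y² = R(x)`. The cofactor is the
  -- quotient on division by `y² - R(x)`; it is linear in `y` because `S³` is cubic in `y`.
  linear_combination (-8 * E ^ 3 * y + ((4 * E ^ 2 + (-4 * A * k ^ 3 - 2 * B * k) * (x + k)) ^ 2
    - 12 * E ^ 2 * (2 * E ^ 2 + (-4 * A * k ^ 3 - 2 * B * k) * (x + k)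
      + (2 * A * k ^ 2 + B) * (x + k) ^ 2) + 8 * B * E ^ 2 * (x + k) ^ 2)) * h

end

lemma Estar_equation_iff (t S T : K) :
    (Estar t).Equation S T ↔ T ^ 2 = S * (S ^ 2 + α t * S + β t) := by
  rw [WeierstrassCurve.Affine.equation_iff]
  simp only [Estar]
  constructor <;> intro h <;> linear_combination h

lemma Estar_equation [CharZero K] (t : K) (i : Fin 6) (hu : x t i + shift t ≠ 0) :
    (Estar t).Equation (S t i) (T t i) := by
  rw [Estar_equation_iff]
  have h := tNum_sq t (F := K) (y_sq t i)
  simp only [Algebra.algebraMap_self, RingHom.id_apply] at h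
  rw [S, T]
  field_simp
  linear_combination h

lemma Estar_Δ (t : K) : (Estar t).Δ = 16 * β t ^ 2 * (α t ^ 2 - 4 * β t) := by
  simp only [WeierstrassCurve.Δ, WeierstrassCurve.b₂, WeierstrassCurve.b₄, WeierstrassCurve.b₆,
    WeierstrassCurve.b₈, Estar]
  ring

lemma Estar_isElliptic [CharZero K] {t : K} (hβ : β t ≠ 0) (hD : α t ^ 2 - 4 * β t ≠ 0) :
    (Estar t).IsElliptic := by
  rw [WeierstrassCurve.isElliptic_iff, isUnit_iff_ne_zero, Estar_Δ]
  exact mul_ne_zero (mul_ne_zero (by norm_num) (pow_ne_zero 2 hβ)) hD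

lemma Estar_nonsingular_zero {t : K} (hβ : β t ≠ 0) : (Estar t).Nonsingular 0 0 := by
  rw [WeierstrassCurve.Affine.nonsingular_zero]
  exact ⟨rfl, Or.inr hβ⟩

lemma Estar_negY (t x y : K) : (Estar t).negY x y = -y := by
  simp [negY, Estar]

lemma addOrderOf_zero_zero [DecidableEq K] {t : K} (h : (Estar t).Nonsingular 0 0) :
    addOrderOf (Point.some 0 0 h) = 2 := by
  refine addOrderOf_eq_prime ?_ (Point.some_ne_zero h)
  rw [two_nsmul]
  exact Point.add_of_Y_eq rfl (by rw [Estar_negY, neg_zero])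

/-- If `α² - 4β` is not a square, then the only rational `2`-torsion is `{0, (0, 0)}`. -/
lemma two_torsion [CharZero K] [DecidableEq K] {t : K} (h : (Estar t).Nonsingular 0 0)
    (hD : ∀ z, z ^ 2 ≠ α t ^ 2 - 4 * β t) (P : (Estar t).Point) (hP : 2 • P = 0) :
    P = 0 ∨ P = Point.some 0 0 h := by
  rcases P with _ | ⟨X, Y, hXY⟩
  · exact Or.inl rfl
  right
  rw [two_nsmul] at hP
  have hY : Y = 0 := by
    by_contra hY
    have hne : Y ≠ (Estar t).negY X Y := by
      rw [Estar_negY]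
      intro h
      exact hY (by linear_combination h / 2)
    rw [Point.add_self_of_Y_ne hne] at hP
    exact Point.some_ne_zero _ hP
  subst hY
  have heq := (Estar_equation_iff t X 0).mp hXY.1
  have hX : X = 0 := by
    by_contra hX
    have : X ^ 2 + α t * X + β t = 0 := by
      rcases mul_eq_zero.mp (show X * (X ^ 2 + α t * X + β t) = 0 by linear_combination -heq) with
        h | h
      · exact absurd h hX
      · exact h
    -- Completing the square: a nonzero root would exhibit `α² - 4β` as a square.
    exact hD (2 * X + α t) (by linear_combination 4 * this)
  subst hX
  rfl

end Curve

/-! ### Compatibility with field embeddings. -/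

section Map

variable {K F : Type*} [Field K] [Field F] (σ : K →+* F) (t : K)

lemma map_a : σ (a t) = a (σ t) := by simp [map_ofNat, a]

lemma map_b : σ (b t) = b (σ t) := by simp [map_ofNat, b]

lemma map_α : σ (α t) = α (σ t) := by simp [map_ofNat, α]

lemma map_β : σ (β t) = β (σ t) := by simp [map_ofNat, β]

lemma map_shift : σ (shift t) = shift (σ t) := by simp [map_ofNat, shift]

lemma map_x (i : Fin 6) : σ (x t i) = x (σ t) i := by simp [map_ofNat, x]

lemma map_Q (u : K) : σ (Q t u) = Q (σ t) (σ u) := by simp [map_ofNat, Q]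

lemma map_S (i : Fin 6) : σ (S t i) = S (σ t) i := by
  simp [map_ofNat, S, sNum, shiftE, shiftD, y, map_a, map_b, map_Q, map_x, map_shift]

end Map

/-! ### Reduction modulo an odd prime. -/

section Residues

variable {p : ℕ} [Fact p.Prime] {t : ℚ_[p]} {τ : ZMod p}

open HasResidue

/-- All numerical denominators in the formulas are powers of 2, so oddness of `p` is the only
condition needed to reduce them. -/
lemma two_pow_ne_zero (hp : (2 : ZMod p) ≠ 0) (n k : ℕ) (h : 2 ^ k = n) : ((n : ℕ) : ZMod p) ≠ 0 := by
  rw [← h]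
  push_cast
  exact pow_ne_zero k hp

lemma hasResidue_a (hp : (2 : ZMod p) ≠ 0) (ht : HasResidue t τ) : HasResidue (a t) (a τ) := by
  have h64 : (64 : ZMod p) ≠ 0 := two_pow_ne_zero hp 64 6 rfl
  unfold a
  with_reducible repeat' first
    | exact ht | exact h64 | apply HasResidue.add | apply HasResidue.mul | apply HasResidue.pow
    | apply HasResidue.div | apply HasResidue.one | apply HasResidue.ofNat

lemma hasResidue_b (hp : (2 : ZMod p) ≠ 0) (ht : HasResidue t τ) : HasResidue (b t) (b τ) := by
  have h512 : (512 : ZMod p) ≠ 0 := two_pow_ne_zero hp 512 9 rfl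
  unfold b
  with_reducible repeat' first
    | exact ht | exact h512 | apply HasResidue.add | apply HasResidue.sub | apply HasResidue.neg
    | apply HasResidue.div | apply HasResidue.mul | apply HasResidue.pow | apply HasResidue.one
    | apply HasResidue.ofNat

lemma hasResidue_α (hp : (2 : ZMod p) ≠ 0) (ht : HasResidue t τ) : HasResidue (α t) (α τ) := by
  have h256 : (256 : ZMod p) ≠ 0 := two_pow_ne_zero hp 256 8 rfl
  unfold α
  with_reducible repeat' first
    | exact ht | exact h256 | apply HasResidue.add | apply HasResidue.sub | apply HasResidue.neg
    | apply HasResidue.div | apply HasResidue.mul | apply HasResidue.pow | apply HasResidue.one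
    | apply HasResidue.ofNat

lemma hasResidue_β (hp : (2 : ZMod p) ≠ 0) (ht : HasResidue t τ) : HasResidue (β t) (β τ) := by
  have h1024 : (1024 : ZMod p) ≠ 0 := two_pow_ne_zero hp 1024 10 rfl
  unfold β
  with_reducible repeat' first
    | exact ht | exact h1024 | apply HasResidue.add | apply HasResidue.sub | apply HasResidue.neg
    | apply HasResidue.div | apply HasResidue.mul | apply HasResidue.pow | apply HasResidue.one
    | apply HasResidue.ofNat

lemma hasResidue_shift (hp : (2 : ZMod p) ≠ 0) (ht : HasResidue t τ) :
    HasResidue (shift t) (shift τ) :=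
  (ht.sub (one.div (ofNat 2) hp)).pow 2

lemma hasResidue_x (hp : (2 : ZMod p) ≠ 0) (ht : HasResidue t τ) (i : Fin 6) :
    HasResidue (x t i) (x τ i) :=
  ((ht.add (natCast _)).sub ((ofNat 5).div (ofNat 2) hp)).pow 2

lemma hasResidue_Q (hp : (2 : ZMod p) ≠ 0) (ht : HasResidue t τ) {u : ℚ_[p]} {v : ZMod p}
    (hu : HasResidue u v) : HasResidue (Q t u) (Q τ v) := by
  have h16 : (16 : ZMod p) ≠ 0 := two_pow_ne_zero hp 16 4 rfl
  have h256 : (256 : ZMod p) ≠ 0 := two_pow_ne_zero hp 256 8 rfl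
  have h4096 : (4096 : ZMod p) ≠ 0 := two_pow_ne_zero hp 4096 12 rfl
  unfold Q
  with_reducible repeat' first
    | exact ht | exact hu | exact h16 | exact h256 | exact h4096 | apply HasResidue.add
    | apply HasResidue.sub | apply HasResidue.neg | apply HasResidue.div | apply HasResidue.mul
    | apply HasResidue.pow | apply HasResidue.one | apply HasResidue.ofNat

lemma hasResidue_S (hp : (2 : ZMod p) ≠ 0) (ht : HasResidue t τ) (i : Fin 6)
    (hu : x τ i + shift τ ≠ 0) : HasResidue (S t i) (S τ i) := by
  have ha := hasResidue_a hp ht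
  have hb := hasResidue_b hp ht
  have hx := hasResidue_x hp ht i
  have hk := hasResidue_shift hp ht
  have hE := hasResidue_Q hp ht hk
  have hy := hasResidue_Q hp ht hx
  unfold S
  refine .div ?_ ((hx.add hk).pow 2) (pow_ne_zero 2 hu)
  simp only [sNum, Algebra.algebraMap_self, RingHom.id_apply, shiftE, shiftD, y]
  with_reducible repeat' first
    | exact ha | exact hb | exact hx | exact hk | exact hE | exact hy | apply HasResidue.add
    | apply HasResidue.sub | apply HasResidue.neg | apply HasResidue.mul | apply HasResidue.pow
    | apply HasResidue.ofNat

end Residues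

/-! ### The characters attached to roots in `ℚ_p`. -/

section Characters

/-- `m` records whether the nonzero residue `v` is a square (`0`) or not (`1`). -/
def IsLegendreBit {p : ℕ} (v : ZMod p) (m : ZMod 2) : Prop :=
  v ≠ 0 ∧ (m = 0 ∧ (∃ s, s * s = v) ∨ m = 1 ∧ ∀ s, s * s ≠ v)

instance {p : ℕ} [NeZero p] (v : ZMod p) (m : ZMod 2) : Decidable (IsLegendreBit v m) := by
  unfold IsLegendreBit
  infer_instance

variable {p : ℕ} [Fact p.Prime]

lemma padicChar_eq {x : ℚ_[p]} {v : ZMod p} {m : ZMod 2} (h : HasResidue x v)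
    (hm : IsLegendreBit v m) : padicChar p x = m := by
  obtain ⟨hv, ⟨rfl, hs⟩ | ⟨rfl, hs⟩⟩ := hm
  · exact padicChar_eq_zero h hv hs
  · exact padicChar_eq_one h hv hs

variable {K : Type*} [Field K] {t : K} {σ : K →+* ℚ_[p]} {τ : ZMod p}

/-- The residues modulo `p` of the data attached to a parameter with residue `τ`. -/
structure ResidueTable (τ : ZMod p) (αr βr : ZMod p) (s : Fin 6 → ZMod p) : Prop where
  two_ne_zero : (2 : ZMod p) ≠ 0
  α_eq : α τ = αr
  β_eq : β τ = βr
  denom_ne_zero : ∀ i, x τ i + shift τ ≠ 0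
  S_eq : ∀ i, S τ i = s i

variable {αr βr : ZMod p} {s : Fin 6 → ZMod p}

namespace ResidueTable

variable (H : ResidueTable τ αr βr s) (ht : HasResidue (σ t) τ)

include H ht

lemma hasResidue_map_α : HasResidue (σ (α t)) αr := by
  rw [map_α, ← H.α_eq]
  exact hasResidue_α H.two_ne_zero ht

lemma hasResidue_map_β : HasResidue (σ (β t)) βr := by
  rw [map_β, ← H.β_eq]
  exact hasResidue_β H.two_ne_zero ht

lemma hasResidue_map_S (i : Fin 6) : HasResidue (σ (S t i)) (s i) := by
  rw [map_S, ← H.S_eq]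
  exact hasResidue_S H.two_ne_zero ht i (H.denom_ne_zero i)

lemma hasResidue_map_disc : HasResidue (σ (α t ^ 2 - 4 * β t)) (αr ^ 2 - 4 * βr) := by
  rw [map_sub, map_mul, map_pow, map_ofNat]
  exact ((H.hasResidue_map_α ht).pow 2).sub ((HasResidue.ofNat 4).mul (H.hasResidue_map_β ht))

lemma denom_ne_zero' (i : Fin 6) : x t i + shift t ≠ 0 := by
  intro h
  have hr := (hasResidue_x H.two_ne_zero ht i).add (hasResidue_shift H.two_ne_zero ht)
  rw [← map_x, ← map_shift, ← map_add, h, map_zero] at hr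
  exact hr.ne_zero (H.denom_ne_zero i) rfl

lemma β_ne_zero (hβ : βr ≠ 0) : β t ≠ 0 := fun h =>
  (H.hasResidue_map_β ht).ne_zero hβ (by rw [h, map_zero])

lemma disc_ne_zero (hD : αr ^ 2 - 4 * βr ≠ 0) : α t ^ 2 - 4 * β t ≠ 0 := fun h =>
  (H.hasResidue_map_disc ht).ne_zero hD (by rw [h, map_zero])

lemma disc_ne_sq (hD : IsLegendreBit (αr ^ 2 - 4 * βr) 1) (z : K) :
    z ^ 2 ≠ α t ^ 2 - 4 * β t := by
  intro h
  have h0 := H.disc_ne_zero ht hD.1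
  have h1 := padicChar_eq (H.hasResidue_map_disc ht) hD
  have hz : σ z ≠ 0 := (map_ne_zero σ).mpr fun hz => h0 (by rw [← h, hz]; ring)
  rw [← h, map_pow, (padicChar p).map_sq hz] at h1
  exact zero_ne_one h1

/-- The character `S mod p`. -/
theorem exists_hom_zero [DecidableEq K] {m : Fin 6 → ZMod 2} {m' : ZMod 2}
    (hm : ∀ i, IsLegendreBit (s i) (m i)) (hm' : IsLegendreBit βr m') :
    ∃ ψ : (Estar t).Point →+ ZMod 2, (∀ i h, ψ (Point.some (S t i) (T t i) h) = m i) ∧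
      ∀ h, ψ (Point.some 0 0 h) = m' := by
  have hd : cubicDeriv (Estar t) σ 0 = σ (β t) := by simp [cubicDeriv, Estar]
  have hβ := H.hasResidue_map_β ht
  have hβ0 := hβ.ne_zero hm'.1
  refine ⟨descentHom (σ := σ) (e := 0) rfl rfl (by simp [Estar]) (hd ▸ hβ0) (padicChar p),
    fun i h => ?_, fun h => ?_⟩
  · have hS := H.hasResidue_map_S ht i
    change padicChar p (descentFun σ 0 _) = _
    rw [descentFun_some_of_ne _ (hS.ne_zero (hm i).1), sub_zero]
    exact padicChar_eq hS (hm i)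
  · change padicChar p (descentFun σ 0 _) = _
    rw [descentFun_some_of_eq _ (map_zero σ), hd]
    exact padicChar_eq hβ hm'

/-- The character `S - e mod p` for a root `e` of `S² + αS + β` in `ℚ_p`, where `r` is the
square root of the discriminant in `𝔽_p` and `e` has residue `er`. -/
theorem exists_hom_root [DecidableEq K] {r er : ZMod p} (hr : r ≠ 0)
    (hr2 : r ^ 2 = αr ^ 2 - 4 * βr) (her : 2 * er = r - αr) {m : Fin 6 → ZMod 2} {m' : ZMod 2}
    (hm : ∀ i, IsLegendreBit (s i - er) (m i)) (hm' : IsLegendreBit (-er) m') :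
    ∃ ψ : (Estar t).Point →+ ZMod 2, (∀ i h, ψ (Point.some (S t i) (T t i) h) = m i) ∧
      ∀ h, ψ (Point.some 0 0 h) = m' := by
  have h2 := H.two_ne_zero
  obtain ⟨w, hw, hwr⟩ := HasResidue.exists_sq_eq h2 hr (hr2 ▸ H.hasResidue_map_disc ht)
  have hα := H.hasResidue_map_α ht
  set e : ℚ_[p] := (w - σ (α t)) / 2 with he
  have heR : HasResidue e er := by
    rw [← mul_div_cancel_left₀ er h2, her]
    exact (hwr.sub hα).div (HasResidue.ofNat 2) h2
  have he0 : e ≠ 0 := heR.ne_zero fun h => hm'.1 (by rw [h, neg_zero])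
  have hw' : w = 2 * e + σ (α t) := by rw [he]; ring
  have hroot : e ^ 2 + σ (α t) * e + σ (β t) = 0 := by
    have : w ^ 2 = σ (α t) ^ 2 - 4 * σ (β t) := by
      rw [hw, map_sub, map_mul, map_pow, map_ofNat]
    rw [hw'] at this
    linear_combination this / 4
  -- The cubic is `S(S - e)(S - e')`, and the square root `w` of the discriminant is `e - e'`.
  have hd : cubicDeriv (Estar t) σ e = e * w := by
    rw [hw']
    simp only [cubicDeriv, Estar]
    linear_combination hroot
  have hd0 : cubicDeriv (Estar t) σ e ≠ 0 := hd ▸ mul_ne_zero he0 (hwr.ne_zero hr)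
  refine ⟨descentHom (σ := σ) (e := e) rfl rfl ?_ hd0 (padicChar p), fun i h => ?_, fun h => ?_⟩
  · simp only [Estar, map_zero]
    linear_combination e * hroot
  · have hS := (H.hasResidue_map_S ht i).sub heR
    change padicChar p (descentFun σ e _) = _
    rw [descentFun_some_of_ne _ (sub_ne_zero.mp (hS.ne_zero (hm i).1))]
    exact padicChar_eq hS (hm i)
  · change padicChar p (descentFun σ e _) = _
    have : σ 0 ≠ e := by rw [map_zero]; exact he0.symm
    rw [descentFun_some_of_ne _ this, map_zero, zero_sub]
    exact padicChar_eq heR.neg hm'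

end ResidueTable

end Characters

/-! ### Numerical data at `t = 3/4` modulo the four primes. -/

section Tables

instance : Fact (Nat.Prime 31) := ⟨by norm_num⟩
instance : Fact (Nat.Prime 43) := ⟨by norm_num⟩
instance : Fact (Nat.Prime 53) := ⟨by norm_num⟩
instance : Fact (Nat.Prime 103) := ⟨by norm_num⟩

/-- Clears the denominator of `S`, so that once the inverses of powers of 2 are replaced by explicit
residues the tables need only ring arithmetic modulo `p`. -/
lemma ResidueTable.of_mul_eq {p : ℕ} [Fact p.Prime] {τ αr βr : ZMod p} {s : Fin 6 → ZMod p}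
    (h2 : (2 : ZMod p) ≠ 0) (hα : α τ = αr) (hβ : β τ = βr)
    (hu : ∀ i, x τ i + shift τ ≠ 0)
    (hs : ∀ i, sNum τ (x τ i) (y τ i) = s i * (x τ i + shift τ) ^ 2) :
    ResidueTable τ αr βr s :=
  ⟨h2, hα, hβ, hu, fun i => by rw [S, hs, mul_div_cancel_right₀ _ (pow_ne_zero 2 (hu i))]⟩

lemma inv_two_pow_31 : (2 : ZMod 31)⁻¹ = 16 ∧ (4 : ZMod 31)⁻¹ = 8 ∧ (16 : ZMod 31)⁻¹ = 2 ∧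
    (64 : ZMod 31)⁻¹ = 16 ∧ (256 : ZMod 31)⁻¹ = 4 ∧ (512 : ZMod 31)⁻¹ = 2 ∧
    (1024 : ZMod 31)⁻¹ = 1 ∧ (4096 : ZMod 31)⁻¹ = 8 := by
  refine ⟨?_, ?_, ?_, ?_, ?_, ?_, ?_, ?_⟩ <;> exact inv_eq_of_mul_eq_one_right (by decide)

lemma table31 : ResidueTable (3 / 4 : ZMod 31) 1 23 ![23, 15, 10, 20, 12, 14] := by
  refine ResidueTable.of_mul_eq (by decide) ?_ ?_ ?_ ?_ <;>
  simp only [α, β, a, b, Q, shift, shiftE, shiftD, sNum, x, y, div_eq_mul_inv, inv_two_pow_31,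
    Algebra.algebraMap_self, RingHom.id_apply] <;>
  decide +kernel

lemma inv_two_pow_43 : (2 : ZMod 43)⁻¹ = 22 ∧ (4 : ZMod 43)⁻¹ = 11 ∧ (16 : ZMod 43)⁻¹ = 35 ∧
    (64 : ZMod 43)⁻¹ = 41 ∧ (256 : ZMod 43)⁻¹ = 21 ∧ (512 : ZMod 43)⁻¹ = 32 ∧
    (1024 : ZMod 43)⁻¹ = 16 ∧ (4096 : ZMod 43)⁻¹ = 4 := by
  refine ⟨?_, ?_, ?_, ?_, ?_, ?_, ?_, ?_⟩ <;> exact inv_eq_of_mul_eq_one_right (by decide)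

lemma table43 : ResidueTable (3 / 4 : ZMod 43) 39 40 ![25, 5, 31, 7, 3, 7] := by
  refine ResidueTable.of_mul_eq (by decide) ?_ ?_ ?_ ?_ <;>
  simp only [α, β, a, b, Q, shift, shiftE, shiftD, sNum, x, y, div_eq_mul_inv, inv_two_pow_43,
    Algebra.algebraMap_self, RingHom.id_apply] <;>
  decide +kernel

lemma inv_two_pow_53 : (2 : ZMod 53)⁻¹ = 27 ∧ (4 : ZMod 53)⁻¹ = 40 ∧ (16 : ZMod 53)⁻¹ = 10 ∧
    (64 : ZMod 53)⁻¹ = 29 ∧ (256 : ZMod 53)⁻¹ = 47 ∧ (512 : ZMod 53)⁻¹ = 50 ∧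
    (1024 : ZMod 53)⁻¹ = 25 ∧ (4096 : ZMod 53)⁻¹ = 46 := by
  refine ⟨?_, ?_, ?_, ?_, ?_, ?_, ?_, ?_⟩ <;> exact inv_eq_of_mul_eq_one_right (by decide)

lemma table53 : ResidueTable (3 / 4 : ZMod 53) 22 9 ![17, 48, 4, 49, 38, 48] := by
  refine ResidueTable.of_mul_eq (by decide) ?_ ?_ ?_ ?_ <;>
  simp only [α, β, a, b, Q, shift, shiftE, shiftD, sNum, x, y, div_eq_mul_inv, inv_two_pow_53,
    Algebra.algebraMap_self, RingHom.id_apply] <;>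
  decide +kernel

lemma inv_two_pow_103 : (2 : ZMod 103)⁻¹ = 52 ∧ (4 : ZMod 103)⁻¹ = 26 ∧ (16 : ZMod 103)⁻¹ = 58 ∧
    (64 : ZMod 103)⁻¹ = 66 ∧ (256 : ZMod 103)⁻¹ = 68 ∧ (512 : ZMod 103)⁻¹ = 34 ∧
    (1024 : ZMod 103)⁻¹ = 17 ∧ (4096 : ZMod 103)⁻¹ = 30 := by
  refine ⟨?_, ?_, ?_, ?_, ?_, ?_, ?_, ?_⟩ <;> exact inv_eq_of_mul_eq_one_right (by decide)

lemma table103 : ResidueTable (3 / 4 : ZMod 103) 100 101 ![79, 35, 25, 8, 24, 85] := by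
  refine ResidueTable.of_mul_eq (by decide) ?_ ?_ ?_ ?_ <;>
  simp only [α, β, a, b, Q, shift, shiftE, shiftD, sNum, x, y, div_eq_mul_inv, inv_two_pow_103,
    Algebra.algebraMap_self, RingHom.id_apply] <;>
  decide +kernel

end Tables

/-- `t` is congruent to `3/4` under some embedding into `ℚ_p`, for each of the four primes used
in the descent. -/
structure NearThreeQuarters {K : Type*} [Field K] (t : K) : Prop where
  at31 : ∃ σ : K →+* ℚ_[31], HasResidue (σ t) (3 / 4)
  at43 : ∃ σ : K →+* ℚ_[43], HasResidue (σ t) (3 / 4)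
  at53 : ∃ σ : K →+* ℚ_[53], HasResidue (σ t) (3 / 4)
  at103 : ∃ σ : K →+* ℚ_[103], HasResidue (σ t) (3 / 4)

/-! ### The descent for parameters close to `3/4`. -/

namespace NearThreeQuarters

variable {K : Type*} [Field K] {t : K} (ht : NearThreeQuarters t)

include ht

lemma denom_ne_zero (i : Fin 6) : x t i + shift t ≠ 0 := by
  obtain ⟨σ, h⟩ := ht.at31
  exact table31.denom_ne_zero' h i

lemma β_ne_zero : β t ≠ 0 := by
  obtain ⟨σ, h⟩ := ht.at31
  exact table31.β_ne_zero h (by decide)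

lemma disc_ne_zero : α t ^ 2 - 4 * β t ≠ 0 := by
  obtain ⟨σ, h⟩ := ht.at31
  exact table31.disc_ne_zero h (by decide)

lemma isElliptic [CharZero K] : (Estar t).IsElliptic :=
  Estar_isElliptic ht.β_ne_zero ht.disc_ne_zero

lemma nonsingular [CharZero K] (i : Fin 6) : (Estar t).Nonsingular (S t i) (T t i) := by
  have := ht.isElliptic
  exact WeierstrassCurve.Affine.equation_iff_nonsingular.mp
    (Estar_equation t i (ht.denom_ne_zero i))

theorem linearIndependent [CharZero K] [DecidableEq K] :
    LinearIndependent ℤ fun i => Point.some (S t i) (T t i) (ht.nonsingular i) := by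
  obtain ⟨σ₁, h₁⟩ := ht.at31
  obtain ⟨σ₂, h₂⟩ := ht.at43
  obtain ⟨σ₃, h₃⟩ := ht.at53
  obtain ⟨σ₄, h₄⟩ := ht.at103
  have h0 := Estar_nonsingular_zero ht.β_ne_zero
  -- The rows are, in order, `S` and `S - e` at 31, `S` at 43, `S` at 53, `S - e` at 53, `S` and `S
  -- - e` at 103. The columns are the `q_i`; the final vector holds the values at `(0, 0)`.
  have hψ : ∀ j : Fin 7, ∃ ψ : (Estar t).Point →+ ZMod 2,
      (∀ i h, ψ (Point.some (S t i) (T t i) h) =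
        (!![1, 1, 0, 0, 1, 0; 0, 1, 1, 0, 1, 1; 0, 1, 0, 1, 1, 1; 0, 1, 0, 0, 0, 1;
          0, 0, 1, 0, 1, 0; 0, 1, 0, 0, 1, 1; 0, 0, 0, 1, 0, 1] : Matrix _ _ (ZMod 2)) j i) ∧
      ∀ h, ψ (Point.some 0 0 h) = (![1, 1, 0, 0, 0, 1, 1] : Fin 7 → ZMod 2) j := by
    intro j
    fin_cases j
    · exact table31.exists_hom_zero h₁ (by decide) (by decide)
    · exact table31.exists_hom_root h₁ (r := 8) (er := 19) (by decide) (by decide) (by decide)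
        (by decide) (by decide)
    · exact table43.exists_hom_zero h₂ (by decide) (by decide)
    · exact table53.exists_hom_zero h₃ (by decide) (by decide)
    · exact table53.exists_hom_root h₃ (r := 17) (er := 24) (by decide) (by decide) (by decide)
        (by decide) (by decide)
    · exact table103.exists_hom_zero h₄ (by decide) (by decide)
    · exact table103.exists_hom_root h₄ (r := 29) (er := 16) (by decide) (by decide) (by decide)
        (by decide) (by decide)
  choose ψ hψq hψτ using hψ
  refine linearIndependent_of_zmod_two_hom (Point.some 0 0 h0)
    -- Modulo 43 the discriminant is `28 = -12²`, a nonresidue since `43 ≡ 3` modulo 4.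
    (two_torsion h0 (table43.disc_ne_sq h₂ (by decide))) _ ψ fun v ε h => ?_
  simp only [hψq, hψτ] at h
  revert v ε
  -- Nonsingularity of the 7 × 7 matrix, checked on all `2⁷` vectors `(v, ε)`.
  decide +kernel

theorem rank_ge [CharZero K] [DecidableEq K] : 6 ≤ Module.rank ℤ (Estar t).Point := by
  simpa using ht.linearIndependent.cardinal_lift_le_rank

end NearThreeQuarters

/-! ### Rational and generic parameters close to `3/4`. -/

section Parameters

lemma hasResidue_three_quarters {p : ℕ} [Fact p.Prime] (hp : (4 : ZMod p) ≠ 0) :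
    HasResidue (3 / 4 : ℚ_[p]) (3 / 4) :=
  (HasResidue.ofNat 3).div (HasResidue.ofNat 4) hp

lemma exists_hasResidue_rat {p : ℕ} [Fact p.Prime] (hp : (4 : ZMod p) ≠ 0) {N : ℕ} (hN : p ∣ N)
    (n : ℕ) : ∃ σ : ℚ →+* ℚ_[p], HasResidue (σ (3 / 4 + N * n)) (3 / 4) := by
  refine ⟨algebraMap ℚ ℚ_[p], ?_⟩
  have h := (hasResidue_three_quarters hp).add ((HasResidue.natCast N).mul (HasResidue.natCast n))
  rw [(ZMod.natCast_eq_zero_iff N p).mpr hN, zero_mul, add_zero] at h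
  simpa using h

theorem nearThreeQuarters_rat (n : ℕ) :
    NearThreeQuarters (3 / 4 + (31 * 43 * 53 * 103 : ℕ) * n : ℚ) where
  at31 := exists_hasResidue_rat (by decide) (by norm_num) n
  at43 := exists_hasResidue_rat (by decide) (by norm_num) n
  at53 := exists_hasResidue_rat (by decide) (by norm_num) n
  at103 := exists_hasResidue_rat (by decide) (by norm_num) n

lemma nearThreeQuarters_three_quarters : NearThreeQuarters (3 / 4 : ℚ) := by
  simpa using nearThreeQuarters_rat 0

/-- The field `ℚ(X)` embeds into `ℚ_p` with `X` arbitrarily close to `3/4`. -/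
lemma exists_hasResidue_ratFunc {p : ℕ} [Fact p.Prime] (hp : (4 : ZMod p) ≠ 0) :
    ∃ σ : RatFunc ℚ →+* ℚ_[p], HasResidue (σ RatFunc.X) (3 / 4) := by
  -- The numbers algebraic over `ℚ` are countable, so transcendental ones are dense in `ℚ_p`. In the
  -- open unit ball around `3/4` every element has the same residue as `3/4`.
  obtain ⟨w, hw, hwt⟩ : ∃ w ∈ Metric.ball (3 / 4 : ℚ_[p]) 1, w ∈ {z | IsAlgebraic ℚ z}ᶜ :=
    ((Algebraic.countable ℚ ℚ_[p]).dense_compl ℚ_[p]).exists_mem_open Metric.isOpen_ball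
      ⟨_, Metric.mem_ball_self one_pos⟩ |>.imp fun _ h => h.symm
  have hinj : Function.Injective (aeval w : ℚ[X] →ₐ[ℚ] ℚ_[p]).toRingHom :=
    transcendental_iff_injective.mp hwt
  refine ⟨IsFractionRing.lift hinj, ?_⟩
  have hX : IsFractionRing.lift hinj (RatFunc.X : RatFunc ℚ) = w := by
    rw [← RatFunc.algebraMap_X, IsFractionRing.lift_algebraMap]
    exact aeval_X w
  rw [hX]
  rw [Metric.mem_ball, dist_eq_norm] at hw
  have h0 : HasResidue (w - 3 / 4) 0 :=
    ⟨⟨w - 3 / 4, hw.le⟩, rfl, HasResidue.toZMod_eq_zero_of_norm_lt_one hw⟩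
  have := h0.add (hasResidue_three_quarters hp)
  rwa [sub_add_cancel, zero_add] at this

theorem nearThreeQuarters_X : NearThreeQuarters (RatFunc.X : RatFunc ℚ) where
  at31 := exists_hasResidue_ratFunc (by decide)
  at43 := exists_hasResidue_ratFunc (by decide)
  at53 := exists_hasResidue_ratFunc (by decide)
  at103 := exists_hasResidue_ratFunc (by decide)

end Parameters

/-! ### Infinitely many `j`-invariants. -/

section JInvariant

/-- The coefficient `α` as a polynomial. -/
noncomputable def αPoly : ℚ[X] :=
  C (9 / 256) * X ^ 2 * (86016 * X ^ 14 + 6113280 * X ^ 12 + 71158528 * X ^ 10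
    + 145053440 * X ^ 8 - 1767894864 * X ^ 6 - 8757574840 * X ^ 4 - 7679989163 * X ^ 2
    + 1441328880)

/-- The coefficient `β` as a polynomial. -/
noncomputable def βPoly : ℚ[X] :=
  -(C (243 / 1024) * X ^ 4) * (4 * X ^ 2 + 17) * (4 * X ^ 2 + 33) * (4 * X ^ 2 + 97)
    * (28 * X ^ 2 + 151) * (4 * X ^ 3 - 48 * X ^ 2 + X - 68)
    * (4 * X ^ 3 - 24 * X ^ 2 + 9 * X - 26) * (4 * X ^ 3 + 24 * X ^ 2 + 9 * X + 26)
    * (4 * X ^ 3 + 48 * X ^ 2 + X + 68) * (20 * X ^ 3 - 24 * X ^ 2 + 125 * X - 10)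
    * (20 * X ^ 3 + 24 * X ^ 2 + 125 * X + 10)

lemma eval_αPoly (t : ℚ) : αPoly.eval t = α t := by
  simp [αPoly, α]

lemma eval_βPoly (t : ℚ) : βPoly.eval t = β t := by
  simp only [βPoly, β, eval_mul, eval_add, eval_sub, eval_neg, eval_pow, eval_X, eval_C,
    eval_ofNat]
  ring

lemma natDegree_αPoly : αPoly.natDegree = 16 := by
  unfold αPoly
  compute_degree!

lemma natDegree_βPoly_le : βPoly.natDegree ≤ 30 := by
  unfold βPoly
  compute_degree

lemma natDegree_c₄Poly : (αPoly ^ 2 - 3 * βPoly).natDegree = 32 := by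
  have hα : (αPoly ^ 2).natDegree = 32 := by rw [natDegree_pow, natDegree_αPoly]
  rw [natDegree_sub_eq_left_of_natDegree_lt, hα]
  rw [hα]
  refine lt_of_le_of_lt (natDegree_mul_le.trans (Nat.add_le_add (natDegree_ofNat 3).le
    natDegree_βPoly_le)) (by norm_num)

/-- The numerator of `j` has degree 96 in `t` and the denominator at most 92, so no value `j` makes
the difference vanish identically. Hence each value is taken at finitely many `t`. -/
lemma jPoly_ne_zero (j : ℚ) :
    256 * (αPoly ^ 2 - 3 * βPoly) ^ 3 - C j * (βPoly ^ 2 * (αPoly ^ 2 - 4 * βPoly)) ≠ 0 := by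
  have h₁ : (256 * (αPoly ^ 2 - 3 * βPoly) ^ 3 : ℚ[X]).natDegree = 96 := by
    have : (256 : ℚ[X]) = C 256 := rfl
    rw [this, natDegree_C_mul (by norm_num), natDegree_pow, natDegree_c₄Poly]
  have h₂ : (C j * (βPoly ^ 2 * (αPoly ^ 2 - 4 * βPoly))).natDegree ≤ 92 := by
    refine (natDegree_C_mul_le _ _).trans (natDegree_mul_le.trans ?_)
    refine Nat.add_le_add (d := 32) (natDegree_pow_le_of_le 2 natDegree_βPoly_le) ?_
    refine (natDegree_sub_le _ _).trans
      (max_le (natDegree_pow_le_of_le 2 natDegree_αPoly.le) ?_)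
    refine (natDegree_mul_le_of_le (natDegree_ofNat 4).le natDegree_βPoly_le).trans (by norm_num)
  intro h
  have := natDegree_sub_eq_left_of_natDegree_lt (h₂.trans_lt (by rw [h₁]; norm_num))
  rw [h, h₁, natDegree_zero] at this
  norm_num at this

lemma eval_jPoly {t : ℚ} [(Estar t).IsElliptic] :
    (256 * (αPoly ^ 2 - 3 * βPoly) ^ 3
      - C (Estar t).j * (βPoly ^ 2 * (αPoly ^ 2 - 4 * βPoly))).eval t = 0 := by
  have hj : (Estar t).j * (Estar t).Δ = (Estar t).c₄ ^ 3 := by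
    rw [WeierstrassCurve.j, ← WeierstrassCurve.coe_Δ']
    rw [mul_right_comm, Units.inv_mul, one_mul]
  have hc : (Estar t).c₄ = 16 * (α t ^ 2 - 3 * β t) := by
    simp only [WeierstrassCurve.c₄, WeierstrassCurve.b₂, WeierstrassCurve.b₄, Estar]
    ring
  rw [Estar_Δ, hc] at hj
  simp only [eval_sub, eval_mul, eval_pow, eval_ofNat, eval_C, eval_αPoly, eval_βPoly]
  linear_combination -hj / 16

theorem infinite_j : {j : ℚ | ∃ t₀ : ℚ, ∃ _ : (Estar t₀).IsElliptic, (Estar t₀).j = j ∧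
      (∃ h : (Estar t₀).Nonsingular 0 0, addOrderOf (Point.some 0 0 h) = 2) ∧
      6 ≤ Module.rank ℤ (Estar t₀).Point}.Infinite := by
  intro hfin
  let t (n : ℕ) : ℚ := 3 / 4 + (31 * 43 * 53 * 103 : ℕ) * n
  have ht (n : ℕ) : NearThreeQuarters (t n) := nearThreeQuarters_rat n
  have htinj : Function.Injective t := fun m n h => by
    have : ((31 * 43 * 53 * 103 : ℕ) : ℚ) ≠ 0 := by norm_num
    simpa [t, this] using h
  have hell (n : ℕ) : (Estar (t n)).IsElliptic := (ht n).isElliptic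
  let f (n : ℕ) : ℚ := (Estar (t n)).j
  refine Set.infinite_univ (α := ℕ) (Set.Finite.of_finite_fibers f (hfin.subset ?_) fun j _ => ?_)
  · rintro _ ⟨n, -, rfl⟩
    have h0 := Estar_nonsingular_zero (ht n).β_ne_zero
    exact ⟨t n, hell n, rfl, ⟨h0, addOrderOf_zero_zero h0⟩, (ht n).rank_ge⟩
  · refine Set.Finite.of_finite_image (f := t) ?_ htinj.injOn
    refine (finite_setOfPred_isRoot (jPoly_ne_zero j)).subset ?_
    rintro _ ⟨n, ⟨-, rfl⟩, rfl⟩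
    exact eval_jPoly

end JInvariant

/-! ### Separability of `R` and irreducibility of `y² - R(x)`. -/

section Quartic

variable {K : Type*} [Field K]

lemma natDegree_R {t : K} (ha : a t ≠ 0) : (R t).natDegree = 4 := by
  unfold R
  compute_degree!

/-- A biquadratic polynomial `a x⁴ + b x² + c` with `a c (b² - 4 a c) ≠ 0` is separable. -/
lemma separable_R [CharZero K] {t : K} (hc : c t ≠ 0) (hβ : β t ≠ 0) : (R t).Separable := by
  rw [β_eq] at hβ
  set δ := 2 * (b t ^ 2 - 4 * a t * c t) with hδ
  have hδ0 : 2 * c t * δ ≠ 0 := mul_ne_zero (mul_ne_zero two_ne_zero hc) (mul_ne_zero two_ne_zero hβ)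
  have hone : (C (2 * c t * δ)⁻¹ * C (2 * c t * δ) : K[X]) = 1 := by
    rw [← C_mul, inv_mul_cancel₀ hδ0, C_1]
  have hhalf : (C (1 / 2 : K) * 2 : K[X]) = 1 := by
    rw [show (2 : K[X]) = C 2 from rfl, ← C_mul]
    norm_num
  have hder : derivative (R t) = 4 * C (a t) * X ^ 3 + 2 * C (b t) * X := by
    simp only [R, derivative_add, derivative_C_mul, derivative_X_pow, derivative_C]
    push_cast
    simp only [C_ofNat]
    ring
  have hC : (C (2 * c t * δ) : K[X]) = 4 * C (c t) * (C (b t) ^ 2 - 4 * C (a t) * C (c t)) := by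
    rw [hδ]
    simp only [map_mul, map_sub, map_pow, C_ofNat]
    ring
  have hCδ : (C δ : K[X]) = 2 * (C (b t) ^ 2 - 4 * C (a t) * C (c t)) := by
    rw [hδ]
    simp only [map_mul, map_sub, map_pow, C_ofNat]
  -- Bézout coefficients of `R` and its derivative: before scaling, the combination is the constant
  -- `2cδ`.
  refine ⟨C (2 * c t * δ)⁻¹ * (2 * (C δ + 4 * C (a t) * C (b t) * X ^ 2)),
    C (2 * c t * δ)⁻¹ * (-(C δ + 4 * C (a t) * C (b t) * X ^ 2) * C (1 / 2) * X
      - C (b t) ^ 2 * X), ?_⟩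
  rw [hder, hCδ, R, ← hone, hC]
  linear_combination (C (2 * c t * δ)⁻¹ * (-(2 * (C (b t) ^ 2 - 4 * C (a t) * C (c t))
    + 4 * C (a t) * C (b t) * X ^ 2) * X * (2 * C (a t) * X ^ 3 + C (b t) * X))) * hhalf

/-- A square dividing a squarefree polynomial is the square of a unit, which contradicts degree 4.
This shows that `y² - R(x)` is irreducible, and later that no nonzero constant multiple of `y` is a
polynomial in `x`. -/
lemma sq_ne_C_mul_R {t : K} (ha : a t ≠ 0) (hR : (R t).Separable) {k : K} (hk : k ≠ 0)
    (q : K[X]) : q ^ 2 ≠ C k * R t := by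
  intro h
  have hu : IsUnit (C k : K[X]) := isUnit_C.mpr hk.isUnit
  have hq : IsUnit q := by
    refine hR.squarefree q ?_
    rw [← sq, h]
    exact (hu.mul_left_dvd).mpr dvd_rfl
  have h4 := natDegree_C_mul (p := R t) hk
  rw [← h, natDegree_pow, natDegree_eq_zero_of_isUnit hq, natDegree_R ha] at h4
  norm_num at h4

lemma quarticPoly_monic (t : K) : (X ^ 2 - C (R t) : K[X][X]).Monic :=
  monic_X_pow_sub_C _ two_ne_zero

lemma quarticPoly_irreducible {t : K} (ha : a t ≠ 0) (hR : (R t).Separable) :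
    Irreducible (X ^ 2 - C (R t) : K[X][X]) := by
  have hdeg : (X ^ 2 - C (R t) : K[X][X]).natDegree = 2 := natDegree_X_pow_sub_C
  rw [(quarticPoly_monic t).irreducible_iff_roots_eq_zero_of_degree_le_three (by rw [hdeg])
    (by rw [hdeg]; norm_num)]
  refine Multiset.eq_zero_of_forall_notMem fun q hq => ?_
  have := (mem_roots'.mp hq).2
  rw [IsRoot, eval_sub, eval_pow, eval_X, eval_C, sub_eq_zero] at this
  exact sq_ne_C_mul_R ha hR one_ne_zero q (by rw [this, C_1, one_mul])

lemma quarticRing_isDomain {t : K} (ha : a t ≠ 0) (hR : (R t).Separable) :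
    IsDomain (QuarticRing t) :=
  AdjoinRoot.isDomain_of_prime (quarticPoly_irreducible ha hR).prime

end Quartic

/-! ### The birational map and its inverse. -/

section Birational

variable {K : Type*} [Field K] {L : Type*} [Field L] [Algebra K L]

/-- Data of a curve `y² = R(x)` inside an extension field `L` of `K`. -/
structure QuarticPoint (t : K) (x y : L) : Prop where
  a_ne_zero : a t ≠ 0
  separable : (R t).Separable
  shiftE_ne_zero : shiftE t ≠ 0
  transcendental : Transcendental K x
  y_sq : y ^ 2 = aeval x (R t)

namespace QuarticPoint

variable {t : K} {x y : L} (H : QuarticPoint t x y)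

include H

lemma smul_y_ne {k : K} (hk : k ≠ 0) (p : K[X]) : algebraMap K L k * y ≠ aeval x p := by
  intro h
  refine sq_ne_C_mul_R H.a_ne_zero H.separable (pow_ne_zero 2 hk) p
    (transcendental_iff_injective.mp H.transcendental ?_)
  rw [map_pow, ← h, mul_pow, H.y_sq, map_mul, aeval_C, map_pow]

lemma denom_ne_zero : x + algebraMap K L (shift t) ≠ 0 := by
  intro h
  refine H.transcendental ⟨X + C (shift t), X_add_C_ne_zero _, ?_⟩
  simpa using h

lemma y_sq' : y ^ 2 = algebraMap K L (a t) * x ^ 4 + algebraMap K L (b t) * x ^ 2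
    + algebraMap K L (c t) := by
  rw [H.y_sq, R]
  simp

lemma equation [CharZero K] :
    (tNum t x y / (x + algebraMap K L (shift t)) ^ 3) ^ 2 =
      (sNum t x y / (x + algebraMap K L (shift t)) ^ 2) ^ 3
        + algebraMap K L (α t) * (sNum t x y / (x + algebraMap K L (shift t)) ^ 2) ^ 2
        + algebraMap K L (β t) * (sNum t x y / (x + algebraMap K L (shift t)) ^ 2) := by
  have hu := H.denom_ne_zero
  have h := tNum_sq t H.y_sq'
  field_simp
  linear_combination h

/-- The inverse of the birational map: a subfield containing `S` and `T` contains `x` and `y`. -/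
lemma mem_of_mem [CharZero K] (M : IntermediateField K L)
    (hS : sNum t x y / (x + algebraMap K L (shift t)) ^ 2 ∈ M)
    (hT : tNum t x y / (x + algebraMap K L (shift t)) ^ 3 ∈ M) : x ∈ M ∧ y ∈ M := by
  have hu := H.denom_ne_zero
  have hM (k : K) : algebraMap K L k ∈ M := M.algebraMap_mem k
  have hL (k : K) (hk : k ≠ 0) : algebraMap K L k ≠ 0 := (_root_.map_ne_zero _).mpr hk
  have hE := H.shiftE_ne_zero
  -- Eliminating `y` between the formulas for `S` and `T` leaves an equation linear in `u = x +
  -- shift`.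
  have hrel : (x + algebraMap K L (shift t)) *
      (algebraMap K L (2 * shiftE t) * (tNum t x y / (x + algebraMap K L (shift t)) ^ 3)
        - algebraMap K L (shiftD t) * (sNum t x y / (x + algebraMap K L (shift t)) ^ 2
          - algebraMap K L (2 * a t * shift t ^ 2 + b t))
        - algebraMap K L (2 * (shiftB t * shiftE t ^ 2))) =
      algebraMap K L (4 * shiftE t ^ 2) * (sNum t x y / (x + algebraMap K L (shift t)) ^ 2
          - algebraMap K L (2 * a t * shift t ^ 2 + b t) + algebraMap K L (shiftC t))
        - algebraMap K L (shiftD t ^ 2) := by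
    simp only [sNum, tNum, map_mul, map_pow, map_ofNat]
    field_simp
    ring
  have hden : algebraMap K L (2 * shiftE t) * (tNum t x y / (x + algebraMap K L (shift t)) ^ 3)
        - algebraMap K L (shiftD t) * (sNum t x y / (x + algebraMap K L (shift t)) ^ 2
          - algebraMap K L (2 * a t * shift t ^ 2 + b t))
        - algebraMap K L (2 * (shiftB t * shiftE t ^ 2)) ≠ 0 := by
    -- Multiplied by `u³`, the coefficient of `u` becomes `8E³y` plus a polynomial in `x`, so its
    -- vanishing would make `8E³y` a polynomial in `x`.
    intro h0
    refine H.smul_y_ne (k := 8 * shiftE t ^ 3)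
      (mul_ne_zero (by norm_num) (pow_ne_zero 3 hE))
      (-(C (8 * shiftE t ^ 4) + C (4 * shiftD t * shiftE t ^ 2) * (X + C (shift t))
        + C (4 * shiftC t * shiftE t ^ 2 - shiftD t ^ 2) * (X + C (shift t)) ^ 2)) ?_
    have := congrArg (· * (x + algebraMap K L (shift t)) ^ 3) h0
    simp only [sNum, tNum, zero_mul] at this
    simp only [map_neg, map_add, map_mul, map_sub, map_pow, aeval_C, aeval_X, map_ofNat]
      at this ⊢
    field_simp at this
    linear_combination this
  have hxu : x + algebraMap K L (shift t) ∈ M := by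
    rw [eq_div_of_mul_eq hden hrel]
    exact M.div_mem (M.sub_mem (M.mul_mem (hM _) (M.add_mem (M.sub_mem hS (hM _)) (hM _))) (hM _))
      (M.sub_mem (M.sub_mem (M.mul_mem (hM _) hT) (M.mul_mem (hM _) (M.sub_mem hS (hM _)))) (hM _))
  have hx : x ∈ M := by simpa using M.sub_mem hxu (hM (shift t))
  refine ⟨hx, ?_⟩
  have hE2 := hL (2 * shiftE t) (mul_ne_zero two_ne_zero hE)
  -- For known `x`, the formula for `S` is linear in `y` with leading coefficient `2E / u²`.
  have hy : y = (sNum t x y / (x + algebraMap K L (shift t)) ^ 2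
      * (x + algebraMap K L (shift t)) ^ 2
      - algebraMap K L (shiftD t) * (x + algebraMap K L (shift t))
      - algebraMap K L (2 * a t * shift t ^ 2 + b t) * (x + algebraMap K L (shift t)) ^ 2)
      / algebraMap K L (2 * shiftE t) - algebraMap K L (shiftE t) := by
    rw [div_mul_cancel₀ _ (pow_ne_zero 2 hu), eq_sub_iff_add_eq, eq_div_iff hE2]
    simp only [sNum, map_mul, map_ofNat]
    ring
  rw [hy]
  exact M.sub_mem (M.div_mem (M.sub_mem (M.sub_mem (M.mul_mem hS (pow_mem hxu 2))
    (M.mul_mem (hM _) hxu)) (M.mul_mem (hM _) (pow_mem hxu 2))) (hM _)) (hM _)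

/-- If `S` were algebraic over `K`, so would be `T` by the curve equation, and then `x`, which is
rational in `S` and `T`. -/
lemma transcendental_S [CharZero K] :
    Transcendental K (sNum t x y / (x + algebraMap K L (shift t)) ^ 2) := by
  intro hS
  have hmem {z : L} : z ∈ algebraicClosure K L ↔ IsAlgebraic K z := mem_algebraicClosure_iff
  have hT : IsAlgebraic K (tNum t x y / (x + algebraMap K L (shift t)) ^ 3) := by
    refine IsAlgebraic.of_pow two_pos ?_
    rw [H.equation]
    exact ((hS.pow 3).add ((isAlgebraic_algebraMap _).mul (hS.pow 2))).add
      ((isAlgebraic_algebraMap _).mul hS)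
  exact H.transcendental (hmem.mp (H.mem_of_mem _ (hmem.mpr hS) (hmem.mpr hT)).1)

/-- The homomorphism of the coordinate ring of `E_t^*` to `L` sending `S, T` to their
expressions in `x, y`. -/
theorem exists_coordinateRing_hom [CharZero K] :
    ∃ f : (Estar t).CoordinateRing →ₐ[K] L, Function.Injective f ∧
      f (CoordinateRing.mk (Estar t) (C X)) = sNum t x y / (x + algebraMap K L (shift t)) ^ 2 ∧
      f (CoordinateRing.mk (Estar t) X) = tNum t x y / (x + algebraMap K L (shift t)) ^ 3 := by
  set S' := sNum t x y / (x + algebraMap K L (shift t)) ^ 2 with hS'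
  set T' := tNum t x y / (x + algebraMap K L (shift t)) ^ 3
  have heq := H.equation
  have hroot : (Estar t).polynomial.eval₂ (aeval S' : K[X] →ₐ[K] L).toRingHom T' = 0 := by
    simp only [WeierstrassCurve.Affine.polynomial, Estar, eval₂_sub, eval₂_add, eval₂_mul,
      eval₂_pow, eval₂_X, eval₂_C, AlgHom.toRingHom_eq_coe, RingHom.coe_coe, map_add, map_mul,
      map_pow, aeval_X, aeval_C, map_zero, eval₂_zero]
    linear_combination heq
  let g : (Estar t).CoordinateRing →+* L := AdjoinRoot.lift _ T' hroot
  have hgC (p : K[X]) : g (CoordinateRing.mk (Estar t) (C p)) = aeval S' p :=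
    AdjoinRoot.lift_of hroot
  have hgX : g (CoordinateRing.mk (Estar t) X) = T' := AdjoinRoot.lift_root hroot
  let f : (Estar t).CoordinateRing →ₐ[K] L :=
    { g with
      commutes' := fun k => by
        have : algebraMap K (Estar t).CoordinateRing k = CoordinateRing.mk (Estar t) (C (C k)) :=
          rfl
        change g _ = _
        rw [this, hgC, aeval_C] }
  refine ⟨f, ?_, (hgC X).trans (aeval_X _), hgX⟩
  change Function.Injective g
  rw [RingHom.injective_iff_ker_eq_bot]
  have : Module.Finite K[X] (Estar t).CoordinateRing :=
    Module.Finite.of_basis (CoordinateRing.basis (Estar t))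
  -- The coordinate ring is a domain finite over `K[S]`, so a nonzero kernel would meet `K[S]`,
  -- against the transcendence of `S`.
  refine Ideal.eq_bot_of_comap_eq_bot (R := K[X]) ?_
  rw [eq_bot_iff]
  intro p hp
  have hp' : aeval S' p = 0 := by rw [← hgC]; exact hp
  by_contra hp0
  exact H.transcendental_S ⟨p, hp0, hp'⟩

/-- If `L` is generated by `x` and `y`, then it is the function field of `E_t^*`. -/
theorem exists_equiv [CharZero K] (hgen : ∀ M : IntermediateField K L, x ∈ M → y ∈ M → M = ⊤) :
    ∃ φ : (Estar t).FunctionField ≃ₐ[K] L,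
      φ (coordS t) * (x + algebraMap K L (shift t)) ^ 2 = sNum t x y ∧
      φ (coordT t) * (x + algebraMap K L (shift t)) ^ 3 = tNum t x y := by
  have hu := H.denom_ne_zero
  obtain ⟨f, hf, hfS, hfT⟩ := H.exists_coordinateRing_hom
  let φ : (Estar t).FunctionField →ₐ[K] L := IsFractionRing.liftAlgHom hf
  have hφ (z : (Estar t).CoordinateRing) : φ (algebraMap _ _ z) = f z :=
    IsFractionRing.lift_algebraMap hf z
  have hφS : φ (coordS t) = sNum t x y / (x + algebraMap K L (shift t)) ^ 2 :=
    (hφ _).trans hfS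
  have hφT : φ (coordT t) = tNum t x y / (x + algebraMap K L (shift t)) ^ 3 :=
    (hφ _).trans hfT
  have hsurj : Function.Surjective φ := by
    have hmem := H.mem_of_mem φ.fieldRange ⟨_, hφS⟩ ⟨_, hφT⟩
    have := hgen _ hmem.1 hmem.2
    intro z
    have hz : z ∈ φ.fieldRange := this ▸ IntermediateField.mem_top
    exact hz
  have hbij : Function.Bijective φ := ⟨φ.injective, hsurj⟩
  refine ⟨AlgEquiv.ofBijective φ hbij, ?_, ?_⟩
  · rw [AlgEquiv.ofBijective_apply, hφS, div_mul_cancel₀ _ (pow_ne_zero 2 hu)]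
  · rw [AlgEquiv.ofBijective_apply, hφT, div_mul_cancel₀ _ (pow_ne_zero 3 hu)]

end QuarticPoint

/-- The birational equivalence between `E_t^*` and `E_t`. -/
theorem exists_functionField_equiv [CharZero K] {t : K} (ha : a t ≠ 0) (hR : (R t).Separable)
    (hE : shiftE t ≠ 0) :
    ∃ φ : (Estar t).FunctionField ≃ₐ[K] QuarticFunctionField t,
      φ (coordS t) * (quarticX t + algebraMap K _ (shift t)) ^ 2 =
        sNum t (quarticX t) (quarticY t) ∧
      φ (coordT t) * (quarticX t + algebraMap K _ (shift t)) ^ 3 =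
        tNum t (quarticX t) (quarticY t) := by
  have := quarticRing_isDomain ha hR
  have hinj := IsFractionRing.injective (QuarticRing t) (QuarticFunctionField t)
  have hof (p : K[X]) : algebraMap (QuarticRing t) (QuarticFunctionField t) (AdjoinRoot.of _ p) =
      aeval (quarticX t) p := by
    induction p using Polynomial.induction_on' with
    | add p q hp hq => rw [map_add, map_add, map_add, hp, hq]
    | monomial n k =>
      rw [← C_mul_X_pow_eq_monomial, map_mul, map_mul, map_mul, map_pow, map_pow, map_pow,
        aeval_X, aeval_C]
      rfl
  have H : QuarticPoint t (quarticX t) (quarticY t) :=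
    { a_ne_zero := ha
      separable := hR
      shiftE_ne_zero := hE
      transcendental := by
        rw [transcendental_iff_injective]
        intro p q hpq
        rw [← hof, ← hof] at hpq
        refine AdjoinRoot.of.injective_of_degree_ne_zero ?_ (hinj hpq)
        rw [degree_X_pow_sub_C two_pos]
        norm_num
      y_sq := by
        rw [← hof, quarticY, ← map_pow]
        congr 1
        have := AdjoinRoot.eval₂_root (X ^ 2 - C (R t))
        rw [eval₂_sub, eval₂_pow, eval₂_X, eval₂_C, sub_eq_zero] at this
        exact this }
  refine H.exists_equiv fun M hx hy => ?_
  -- A subfield containing `x` and `y` contains the coordinate ring, hence its fraction field.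
  have hmem (z : QuarticRing t) : algebraMap (QuarticRing t) (QuarticFunctionField t) z ∈ M := by
    induction z using AdjoinRoot.induction_on with
    | ih p =>
      induction p using Polynomial.induction_on' with
      | add p q hp hq => rw [map_add, map_add]; exact M.add_mem hp hq
      | monomial n q =>
        rw [← C_mul_X_pow_eq_monomial, map_mul, map_pow, AdjoinRoot.mk_C, AdjoinRoot.mk_X,
          map_mul, map_pow, hof]
        refine M.mul_mem ?_ (pow_mem hy n)
        have hq := aeval_algHom_apply M.val ⟨quarticX t, hx⟩ q
        exact hq ▸ (aeval (⟨quarticX t, hx⟩ : M) q).2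
  rw [eq_top_iff]
  intro z _
  obtain ⟨p, q, -, rfl⟩ := IsFractionRing.div_surjective (A := QuarticRing t) z
  exact M.div_mem (hmem p) (hmem q)

end Birational

namespace NearThreeQuarters

variable {K : Type*} [Field K] {t : K} (ht : NearThreeQuarters t)

include ht

/-- The discriminant `α² - 4β` equals `16ac`. -/
lemma a_mul_c_ne_zero [CharZero K] : a t * c t ≠ 0 := fun h =>
  ht.disc_ne_zero (by rw [α_eq, β_eq]; linear_combination 16 * h)

lemma shiftE_ne_zero : shiftE t ≠ 0 := by
  obtain ⟨σ, h⟩ := ht.at31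
  intro h0
  have hr := hasResidue_Q (by decide) h (hasResidue_shift (by decide) h)
  rw [← map_shift, ← map_Q, ← shiftE, h0, map_zero] at hr
  refine hr.ne_zero ?_ rfl
  simp only [Q, shift, div_eq_mul_inv, inv_two_pow_31]
  decide +kernel

end NearThreeQuarters

end ConsecutiveSquares

theorem mainTheorem3 [DecidableEq (RatFunc ℚ)] :
    -- `E_t : y² = R(x)` is a smooth quartic over `ℚ(t)` through the six points `(x_i, y_i)`
    ((ConsecutiveSquares.R (RatFunc.X : RatFunc ℚ)).natDegree = 4 ∧
      (ConsecutiveSquares.R (RatFunc.X : RatFunc ℚ)).Separable ∧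
      ∀ i, ConsecutiveSquares.y (RatFunc.X : RatFunc ℚ) i ^ 2 =
        (ConsecutiveSquares.R RatFunc.X).eval (ConsecutiveSquares.x RatFunc.X i)) ∧
    -- `E_t` is birational over `ℚ(t)` to the elliptic curve `E_t^*` by the explicit map
    ((ConsecutiveSquares.Estar (RatFunc.X : RatFunc ℚ)).IsElliptic ∧
      ∃ φ : (ConsecutiveSquares.Estar (RatFunc.X : RatFunc ℚ)).FunctionField ≃ₐ[RatFunc ℚ]
          ConsecutiveSquares.QuarticFunctionField (RatFunc.X : RatFunc ℚ),
        φ (ConsecutiveSquares.coordS RatFunc.X) *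
            (ConsecutiveSquares.quarticX RatFunc.X +
              algebraMap (RatFunc ℚ) _ (ConsecutiveSquares.shift RatFunc.X)) ^ 2 =
          ConsecutiveSquares.sNum (RatFunc.X : RatFunc ℚ)
            (ConsecutiveSquares.quarticX RatFunc.X) (ConsecutiveSquares.quarticY RatFunc.X) ∧
        φ (ConsecutiveSquares.coordT RatFunc.X) *
            (ConsecutiveSquares.quarticX RatFunc.X +
              algebraMap (RatFunc ℚ) _ (ConsecutiveSquares.shift RatFunc.X)) ^ 3 =
          ConsecutiveSquares.tNum (RatFunc.X : RatFunc ℚ)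
            (ConsecutiveSquares.quarticX RatFunc.X) (ConsecutiveSquares.quarticY RatFunc.X)) ∧
    -- `(0, 0)` is a rational point of order two on `E_t^*`
    (∃ h : (ConsecutiveSquares.Estar (RatFunc.X : RatFunc ℚ)).Nonsingular 0 0,
      addOrderOf (WeierstrassCurve.Affine.Point.some 0 0 h) = 2) ∧
    -- the points `q_i = (S_i, T_i)` are well defined and independent in `E_t^*(ℚ(t))`
    ((∀ i, ConsecutiveSquares.x (RatFunc.X : RatFunc ℚ) i + ConsecutiveSquares.shift RatFunc.X ≠ 0) ∧
      ∃ h : ∀ i, (ConsecutiveSquares.Estar (RatFunc.X : RatFunc ℚ)).Nonsingular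
          (ConsecutiveSquares.S RatFunc.X i) (ConsecutiveSquares.T RatFunc.X i),
        LinearIndependent ℤ (fun i => WeierstrassCurve.Affine.Point.some
          (ConsecutiveSquares.S (RatFunc.X : RatFunc ℚ) i)
          (ConsecutiveSquares.T RatFunc.X i) (h i))) ∧
    -- already their specializations at `t = 3/4` are independent
    ((∀ i, ConsecutiveSquares.x (3 / 4 : ℚ) i + ConsecutiveSquares.shift (3 / 4) ≠ 0) ∧
      (ConsecutiveSquares.Estar (3 / 4 : ℚ)).IsElliptic ∧
      ∃ h : ∀ i, (ConsecutiveSquares.Estar (3 / 4 : ℚ)).Nonsingular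
          (ConsecutiveSquares.S (3 / 4) i) (ConsecutiveSquares.T (3 / 4) i),
        LinearIndependent ℤ (fun i => WeierstrassCurve.Affine.Point.some
          (ConsecutiveSquares.S (3 / 4 : ℚ) i) (ConsecutiveSquares.T (3 / 4) i) (h i))) ∧
    -- `E_t^*` has rank at least `6` over `ℚ(t)`
    6 ≤ Module.rank ℤ (ConsecutiveSquares.Estar (RatFunc.X : RatFunc ℚ)).Point ∧
    -- infinite family over `ℚ`, with infinitely many `j`-invariants
    {j : ℚ | ∃ t₀ : ℚ, ∃ _ : (ConsecutiveSquares.Estar t₀).IsElliptic,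
      (ConsecutiveSquares.Estar t₀).j = j ∧
      (∃ h : (ConsecutiveSquares.Estar t₀).Nonsingular 0 0,
        addOrderOf (WeierstrassCurve.Affine.Point.some 0 0 h) = 2) ∧
      6 ≤ Module.rank ℤ (ConsecutiveSquares.Estar t₀).Point}.Infinite := by
  have h := ConsecutiveSquares.nearThreeQuarters_X
  have ha := left_ne_zero_of_mul h.a_mul_c_ne_zero
  have hc := right_ne_zero_of_mul h.a_mul_c_ne_zero
  have hR := ConsecutiveSquares.separable_R hc h.β_ne_zero
  have h0 := ConsecutiveSquares.Estar_nonsingular_zero h.β_ne_zero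
  have h34 := ConsecutiveSquares.nearThreeQuarters_three_quarters
  exact ⟨⟨ConsecutiveSquares.natDegree_R ha, hR, ConsecutiveSquares.y_sq_eq_eval _⟩,
    ⟨h.isElliptic, ConsecutiveSquares.exists_functionField_equiv ha hR h.shiftE_ne_zero⟩,
    ⟨h0, ConsecutiveSquares.addOrderOf_zero_zero h0⟩,
    ⟨h.denom_ne_zero, h.nonsingular, h.linearIndependent⟩,
    ⟨h34.denom_ne_zero, h34.isElliptic, h34.nonsingular, h34.linearIndependent⟩,
    h.rank_ge, ConsecutiveSquares.infinite_j⟩
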